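/- Let $\mathscr M$ be a $II_1$ factor acting on a complex Hilbert space $\mathscr H$, i.e. a von Neumann algebra $\mathscr M\neq\{0\}$ on $\mathscr H$ with centre $\mathbb C I$, in which every isometry is unitary and which has no minimal projections. Let $\tau$ be its faithful normal tracial state. For $\varepsilon,\delta>0$ let $$\mathcal O_\tau(\varepsilon,\delta)=\{A\in\mathscr M:\ \|AE\|\le\varepsilon\ \text{and}\ \tau(I-E)\le\delta\ \text{for some projection } E\in\mathscr M\},$$ and let the measure topology be the translation-invariant topology on $\mathscr M$ in which the sets $\mathcal O_\tau(\varepsilon,\delta)$ form a fundamental system of neighbourhoods of $0$. The ultraweak topology on $\mathscr M$ is the coarsest topology making continuous all functionals $A\mapsto\sum_{i}\langle A y_i,x_i\rangle$ with $x_i,y_i\in\mathscr H$ ($i\in\mathbb N$), $\sum_i\|x_i\|^2<\infty$ and $\sum_i\|y_i\|^2<\infty$. The unit ball of $\mathscr M$ is $(\mathscr M)_1=\{A\in\mathscr M:\|A\|\le 1\}$. Then: (i) the measure topology on $\mathscr M$ is coarser than the norm topology; (ii) the measure topology on $\mathscr M$ is neither coarser nor finer than the ultraweak topology; (iii) the trace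 $\tau:\mathscr M\to\mathbb C$ is not continuous in the measure topology; (iv) the restriction of $\tau$ to $(\mathscr M)_1$ is continuous in the measure topology; (v) $(\mathscr M)_1$ is not compact in the measure topology; (vi) $(\mathscr M)_1$ is complete in the measure topology, i.e. every Cauchy net (equivalently, Cauchy filter) in $(\mathscr M)_1$ converges in the measure topology to an element of $(\mathscr M)_1$. -/

import Mathlib

open scoped ComplexOrder Topology

noncomputable section

namespace MeasureTop

universe u

variable {H : Type u} [NormedAddCommGroup H] [InnerProductSpace ℂ H] [CompleteSpace H]

/-- A von Neumann algebra `M` on `H` is a factor of type `II₁`: `H ≠ 0`, the centre of `M` consists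
of the scalars, `M` is finite (every isometry in `M` is a unitary), and `M` has no minimal
projections. -/
structure IsTypeII₁Factor (M : VonNeumannAlgebra H) : Prop where
  nontrivial : Nontrivial H
  center_trivial : ∀ z ∈ M, (∀ a ∈ M, z * a = a * z) → ∃ c : ℂ, z = c • (1 : H →L[ℂ] H)
  finite : ∀ v ∈ M, star v * v = 1 → v * star v = 1
  no_minimal_projection : ∀ p ∈ M, IsStarProjection p → p ≠ 0 →
    ∃ q ∈ M, IsStarProjection q ∧ q ≤ p ∧ q ≠ 0 ∧ q ≠ p

/-- `τ` is a faithful normal tracial state on `M`. Normality is the order-theoretic one: `τ`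
preserves the least upper bounds in `M` of increasing nets (here: directed sets) of self-adjoint
elements. All order relations between operators refer to the usual (Loewner) order. -/
structure IsFaithfulNormalTracialState (M : VonNeumannAlgebra H)
    (τ : M.toStarSubalgebra →ₗ[ℂ] ℂ) : Prop where
  map_one : τ 1 = 1
  nonneg : ∀ a, 0 ≤ τ (star a * a)
  tracial : ∀ a b, τ (a * b) = τ (b * a)
  faithful : ∀ a, τ (star a * a) = 0 → a = 0
  normal : ∀ (D : Set M.toStarSubalgebra) (s : M.toStarSubalgebra),
    (∀ a ∈ D, IsSelfAdjoint a) → D.Nonempty → DirectedOn (· ≤ ·) D → IsLUB D s →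
    IsLUB ((fun a => (τ a).re) '' D) (τ s).re

/-- The set `O_τ(ε, δ)` of those `A` in `M` for which there is a projection `E` in `M` with
`‖A E‖ ≤ ε` and `τ (I - E) ≤ δ`. -/
def measureBall (M : VonNeumannAlgebra H) (τ : M.toStarSubalgebra →ₗ[ℂ] ℂ) (ε δ : ℝ) :
    Set M.toStarSubalgebra :=
  {A | ∃ E : M.toStarSubalgebra, IsStarProjection E ∧ ‖A * E‖ ≤ ε ∧ (τ (1 - E)).re ≤ δ}

theorem measureBall_mono (M : VonNeumannAlgebra H) (τ : M.toStarSubalgebra →ₗ[ℂ] ℂ)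
    {ε ε' δ δ' : ℝ} (hε : ε ≤ ε') (hδ : δ ≤ δ') :
    measureBall M τ ε δ ⊆ measureBall M τ ε' δ' := by
  rintro A ⟨E, hE, h1, h2⟩
  exact ⟨E, hE, h1.trans hε, h2.trans hδ⟩

/-- The measure topology on `M`: the translation-invariant topology in which the sets
`O_τ(ε, δ)`, `ε, δ > 0`, form a fundamental system of neighbourhoods of `0`. -/
abbrev measureTopology (M : VonNeumannAlgebra H) (τ : M.toStarSubalgebra →ₗ[ℂ] ℂ) :
    TopologicalSpace M.toStarSubalgebra where
  IsOpen U := ∀ A ∈ U, ∃ ε > 0, ∃ δ > 0, ∀ B, B - A ∈ measureBall M τ ε δ → B ∈ U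
  isOpen_univ := fun _ _ => ⟨1, one_pos, 1, one_pos, fun _ _ => trivial⟩
  isOpen_inter := by
    rintro U V hU hV A ⟨hAU, hAV⟩
    obtain ⟨ε, hε, δ, hδ, h⟩ := hU A hAU
    obtain ⟨ε', hε', δ', hδ', h'⟩ := hV A hAV
    exact ⟨min ε ε', lt_min hε hε', min δ δ', lt_min hδ hδ', fun B hB =>
      ⟨h B (measureBall_mono M τ (min_le_left _ _) (min_le_left _ _) hB),
        h' B (measureBall_mono M τ (min_le_right _ _) (min_le_right _ _) hB)⟩⟩
  isOpen_sUnion := by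
    rintro S hS A ⟨U, hU, hAU⟩
    obtain ⟨ε, hε, δ, hδ, h⟩ := hS U hU A hAU
    exact ⟨ε, hε, δ, hδ, fun B hB => ⟨U, hU, h B hB⟩⟩

/-- The operator norm topology on `M`. -/
abbrev normTopology (M : VonNeumannAlgebra H) : TopologicalSpace M.toStarSubalgebra :=
  TopologicalSpace.induced (fun A => (A : H →L[ℂ] H)) UniformSpace.toTopologicalSpace

/-- The ultraweak topology on `M`: the coarsest topology for which all functionals
`A ↦ ∑ i, ⟪x i, A (y i)⟫` with `∑ i, ‖x i‖ ^ 2 < ∞` and `∑ i, ‖y i‖ ^ 2 < ∞` are continuous. -/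
abbrev ultraweakTopology (M : VonNeumannAlgebra H) : TopologicalSpace M.toStarSubalgebra :=
  ⨅ (x : ℕ → H) (y : ℕ → H) (_ : Summable fun i => ‖x i‖ ^ 2) (_ : Summable fun i => ‖y i‖ ^ 2),
    TopologicalSpace.induced
      (fun A : M.toStarSubalgebra => ∑' i, inner ℂ (x i) ((A : H →L[ℂ] H) (y i))) inferInstance

/-- The closed unit ball of `M` in the operator norm. -/
def unitBall (M : VonNeumannAlgebra H) : Set M.toStarSubalgebra :=
  {A | ‖(A : H →L[ℂ] H)‖ ≤ 1}

/-- A subset `S` of `M` is complete for a (group) topology `t` on `M`: every Cauchy filter (that is,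
a proper filter `F` such that for each neighbourhood `U` of `0` there is a member of `F` all of whose
differences lie in `U`) containing `S` converges to a point of `S`. -/
def IsCompleteFor {M : VonNeumannAlgebra H} (t : TopologicalSpace M.toStarSubalgebra)
    (S : Set M.toStarSubalgebra) : Prop :=
  ∀ F : Filter M.toStarSubalgebra, F.NeBot → S ∈ F →
    (∀ U ∈ @nhds _ t 0, ∃ T ∈ F, ∀ A ∈ T, ∀ B ∈ T, A - B ∈ U) →
    ∃ A ∈ S, F ≤ @nhds _ t A

end MeasureTop

end

open MeasureTop

namespace MeasureTop

universe u

variable {H : Type u} [NormedAddCommGroup H] [InnerProductSpace ℂ H] [CompleteSpace H]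
  {M : VonNeumannAlgebra H} {τ : M.toStarSubalgebra →ₗ[ℂ] ℂ}

/-! Three facts carry the proof. The first is countable subadditivity of the trace on joins of
projections (`re_join_le`), obtained from normality without comparison theory. With `t_N = (1 + N
∑_{i<N} p_i)⁻¹`, the elements `1 - t_N` increase strongly to the join `q` of the `p_i`, and `τ(1 -
t_N) = ∑ N τ(p_i t_N p_i) ≤ ∑ τ(p_i)`. Hence sums of measure balls lie in measure balls, so the
balls really are neighbourhoods.

The second is that, as there are no minimal projections, a maximal chain of projections attains
every trace in `[0,1]`, so `1` splits into `N` orthogonal projections of trace `1/N`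
(`exists_partition`). The third is that an element `X` of a ball with `‖X‖ ≤ r` satisfies `τ(X*X) ≤
ε² + r²δ` (`re_star_mul_self_le`).

Any scalar multiple of a projection of small trace is small in measure, so neither the trace nor a
vector functional is continuous. Conversely, real combinations of the `P_i` with coefficients almost
all `±1` can kill any finite set of functionals while keeping `τ(A*A) ≥ 1/2` (`exists_common_zero`).
Such elements lie in every ultraweak neighbourhood of `0`, and they escape any finite cover of the
unit ball by small measure balls. Continuity of `τ` on the unit ball follows from `|τ(X)|² ≤
τ(X*X)`. For completeness, a fast Cauchy sequence converges uniformly off projections of trace at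
most `2·2⁻ⁿ`, hence strongly, to an element of the bicommutant. -/

theorem mem_of_commute (a : H →L[ℂ] H) (h : ∀ c ∈ M.commutant, c * a = a * c) :
    a ∈ M.toStarSubalgebra := by
  have : a ∈ M.commutant.commutant := VonNeumannAlgebra.mem_commutant_iff.2 h
  rw [VonNeumannAlgebra.commutant_commutant] at this
  exact this

theorem commute_of_mem {a : H →L[ℂ] H} (ha : a ∈ M.toStarSubalgebra) {c : H →L[ℂ] H}
    (hc : c ∈ M.commutant) : c * a = a * c :=
  ((VonNeumannAlgebra.mem_commutant_iff.1 hc) a ha).symm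

/-- The square root is a function of `a`, so it commutes with the commutant and stays in `M`. This
makes `τ` monotone for the Loewner order. -/
theorem exists_star_mul_self_of_nonneg (a : M.toStarSubalgebra) (ha : 0 ≤ (a : H →L[ℂ] H)) :
    ∃ b : M.toStarSubalgebra, star b * b = a := by
  have hs : IsSelfAdjoint (CFC.sqrt (a : H →L[ℂ] H)) := (CFC.sqrt_nonneg _).isSelfAdjoint
  have hmem : CFC.sqrt (a : H →L[ℂ] H) ∈ M.toStarSubalgebra := by
    refine mem_of_commute _ fun c hc => ?_
    have : Commute (a : H →L[ℂ] H) c := (commute_of_mem a.2 hc).symm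
    rw [CFC.sqrt_eq_cfc]
    exact (this.cfc_nnreal _).eq.symm
  refine ⟨⟨_, hmem⟩, Subtype.ext ?_⟩
  change star (CFC.sqrt (a : H →L[ℂ] H)) * CFC.sqrt (a : H →L[ℂ] H) = a
  rw [hs.star_eq, CFC.sqrt_mul_sqrt_self _ ha]

namespace IsFaithfulNormalTracialState

theorem apply_nonneg (hτ : IsFaithfulNormalTracialState M τ) {a : M.toStarSubalgebra} (ha : 0 ≤ (a : H →L[ℂ] H)) : 0 ≤ τ a := by
  obtain ⟨b, rfl⟩ := exists_star_mul_self_of_nonneg a ha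
  exact hτ.nonneg b

theorem re_nonneg (hτ : IsFaithfulNormalTracialState M τ) {a : M.toStarSubalgebra} (ha : 0 ≤ (a : H →L[ℂ] H)) : 0 ≤ (τ a).re :=
  (Complex.nonneg_iff.1 (hτ.apply_nonneg ha)).1

theorem re_mono (hτ : IsFaithfulNormalTracialState M τ) {a b : M.toStarSubalgebra} (h : a ≤ b) : (τ a).re ≤ (τ b).re := by
  have : 0 ≤ ((b - a : M.toStarSubalgebra) : H →L[ℂ] H) := sub_nonneg.2 h
  simpa using hτ.re_nonneg this

/-- Polarization: `τ(b*b)` is real for `b = a`, `a + 1` and `a + i`. -/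
theorem map_star (hτ : IsFaithfulNormalTracialState M τ) (a : M.toStarSubalgebra) : τ (star a) = star (τ a) := by
  have h1 := (Complex.nonneg_iff.1 (hτ.nonneg (a + 1))).2
  have h2 := (Complex.nonneg_iff.1 (hτ.nonneg (a + Complex.I • 1))).2
  have h3 := (Complex.nonneg_iff.1 (hτ.nonneg a)).2
  have e2 : star (a + Complex.I • (1 : M.toStarSubalgebra)) * (a + Complex.I • 1)
      = star a * a + Complex.I • star a - Complex.I • a + 1 := by
    simp only [star_add, star_smul, star_one, add_mul, mul_add, smul_mul_assoc, one_mul,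
      mul_smul_comm, mul_one, smul_add]
    rw [smul_smul]
    simp [sub_eq_add_neg]
    abel
  rw [e2] at h2
  simp [add_mul, mul_add, hτ.map_one, ← h3] at h1 h2
  apply Complex.ext <;> simp <;> linarith

/-- The variance `τ((a - τ(a))*(a - τ(a)))` is nonnegative. -/
theorem norm_sq_le (hτ : IsFaithfulNormalTracialState M τ) (a : M.toStarSubalgebra) : ‖τ a‖ ^ 2 ≤ (τ (star a * a)).re := by
  have h := (Complex.nonneg_iff.1 (hτ.nonneg (a - τ a • 1))).1
  have e : star (a - τ a • (1 : M.toStarSubalgebra)) * (a - τ a • 1)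
      = star a * a - τ a • star a - star (τ a) • a + (star (τ a) * τ a) • 1 := by
    simp only [star_sub, star_smul, star_one, sub_mul, mul_sub, smul_mul_assoc, one_mul,
      mul_smul_comm, mul_one, smul_sub]
    rw [smul_smul, mul_comm (τ a)]
    abel
  rw [e] at h
  simp only [map_add, map_sub, map_smul, hτ.map_star, hτ.map_one] at h
  simp at h
  rw [Complex.sq_norm, Complex.normSq_apply]
  nlinarith

end IsFaithfulNormalTracialState

/-! ### Projections, joins and the use of normality -/

theorem coe_isStarProjection {p : M.toStarSubalgebra} (hp : IsStarProjection p) :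
    IsStarProjection (p : H →L[ℂ] H) :=
  hp.map M.toStarSubalgebra.subtype

theorem isStarProjection_of_coe {p : M.toStarSubalgebra}
    (hp : IsStarProjection (p : H →L[ℂ] H)) : IsStarProjection p :=
  ⟨Subtype.ext hp.isIdempotentElem, Subtype.ext hp.isSelfAdjoint⟩

theorem proj_apply_apply {p : H →L[ℂ] H} (hp : IsStarProjection p) (x : H) : p (p x) = p x :=
  congrArg (fun q : H →L[ℂ] H => q x) hp.isIdempotentElem

theorem inner_proj {p : H →L[ℂ] H} (hp : IsStarProjection p) (x y : H) :
    inner ℂ (p x) y = inner ℂ x (p y) := by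
  conv_rhs => rw [← hp.isSelfAdjoint.star_eq, ContinuousLinearMap.star_eq_adjoint]
  rw [ContinuousLinearMap.adjoint_inner_right]

theorem inner_proj_self {p : H →L[ℂ] H} (hp : IsStarProjection p) (x : H) :
    inner ℂ x (p x) = (‖p x‖ ^ 2 : ℝ) := by
  rw [← proj_apply_apply hp, ← inner_proj hp, inner_self_eq_norm_sq_to_K]
  simp [proj_apply_apply hp]

/-- The orthogonal projection onto the closed span of the ranges of a family of operators in `M`. -/
theorem exists_join {ι : Type*} (p : ι → M.toStarSubalgebra) :
    ∃ q : M.toStarSubalgebra, IsStarProjection q ∧ (∀ i x, q.1 ((p i).1 x) = (p i).1 x) ∧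
      ∀ K : Submodule ℂ H, IsClosed (K : Set H) → (∀ i x, (p i).1 x ∈ K) → ∀ x, q.1 x ∈ K := by
  let K : Submodule ℂ H := (⨆ i, LinearMap.range (p i).1.toLinearMap).topologicalClosure
  have hK : IsClosed (K : Set H) := Submodule.isClosed_topologicalClosure _
  have : CompleteSpace K := hK.completeSpace_coe
  have hpK : ∀ i x, (p i).1 x ∈ K := fun i x =>
    Submodule.le_topologicalClosure _ (Submodule.mem_iSup_of_mem i ⟨x, rfl⟩)
  have hp : IsStarProjection K.starProjection := by
    exact isStarProjection_starProjection
  have hmin : ∀ L : Submodule ℂ H, IsClosed (L : Set H) → (∀ i x, (p i).1 x ∈ L) → K ≤ L := by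
    intro L hL h
    refine Submodule.topologicalClosure_minimal _ (iSup_le fun i => ?_) hL
    rintro _ ⟨x, rfl⟩
    exact h i x
  -- A projection lies in `M` when its range is invariant under the commutant.
  have hmem : K.starProjection ∈ M := by
    rw [VonNeumannAlgebra.IsStarProjection.mem_iff hp]
    intro y hy
    rw [Submodule.range_starProjection, Module.End.mem_invtSubmodule]
    refine hmin (K.comap y.toLinearMap) (hK.preimage y.continuous) fun i x => ?_
    have : y ((p i).1 x) = (p i).1 (y x) :=
      congrArg (fun q : H →L[ℂ] H => q x) (commute_of_mem (p i).2 hy)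
    change y ((p i).1 x) ∈ K
    rw [this]
    exact hpK _ _
  refine ⟨⟨_, hmem⟩, isStarProjection_of_coe hp, fun i x => ?_, fun L hL h x => ?_⟩
  · exact Submodule.starProjection_eq_self_iff.2 (hpK i x)
  · exact hmin L hL h (Submodule.starProjection_apply_mem _ _)

theorem nonneg_iff_inner {H : Type*} [NormedAddCommGroup H] [InnerProductSpace ℂ H] (a : H →L[ℂ] H) : 0 ≤ a ↔ ∀ x, 0 ≤ inner ℂ (a x) x := by
  rw [ContinuousLinearMap.nonneg_iff_isPositive]
  refine ⟨fun h x => h.inner_nonneg_left x, fun h => ?_⟩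
  rw [ContinuousLinearMap.isPositive_iff_complex]
  intro x
  have := Complex.nonneg_iff.1 (h x)
  refine ⟨Complex.ext rfl ?_, this.1⟩
  simp [← this.2]

theorem le_iff_inner (a b : H →L[ℂ] H) : a ≤ b ↔ ∀ x, inner ℂ (a x) x ≤ inner ℂ (b x) x := by
  rw [← sub_nonneg, nonneg_iff_inner]
  simp

theorem inner_proj_self_left {p : H →L[ℂ] H} (hp : IsStarProjection p) (x : H) :
    inner ℂ (p x) x = (‖p x‖ ^ 2 : ℝ) := by
  rw [inner_proj hp, inner_proj_self hp]

theorem norm_proj_le {p : H →L[ℂ] H} (hp : IsStarProjection p) (x : H) : ‖p x‖ ≤ ‖x‖ := by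
  simpa using p.le_of_opNorm_le hp.norm_le x

/-- An upper bound of a set of self-adjoint elements which is approximated by that set in the weak
operator topology is its least upper bound. -/
theorem isLUB_of_inner_approx {D : Set M.toStarSubalgebra} {q : M.toStarSubalgebra}
    (hD : D.Nonempty) (hq : ∀ c ∈ D, c ≤ q)
    (h : ∀ x, ∀ ε > 0, ∃ c ∈ D, (inner ℂ (q.1 x) x).re - ε ≤ (inner ℂ (c.1 x) x).re) :
    IsLUB D q := by
  refine ⟨hq, fun b hb => ?_⟩
  change q.1 ≤ b.1
  rw [le_iff_inner]
  intro x
  obtain ⟨c₀, hc₀⟩ := hD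
  have h1 := (Complex.le_def.1 ((le_iff_inner _ _).1 (hq c₀ hc₀) x)).2
  have h2 := (Complex.le_def.1 ((le_iff_inner _ _).1 (hb hc₀) x)).2
  refine Complex.le_def.2 ⟨le_of_forall_pos_le_add fun ε hε => ?_, h1.symm.trans h2⟩
  obtain ⟨c, hc, h3⟩ := h x ε hε
  have h4 := (Complex.le_def.1 ((le_iff_inner _ _).1 (hb hc) x)).1
  linarith

theorem IsFaithfulNormalTracialState.re_le_of_inner_approx
    (hτ : IsFaithfulNormalTracialState M τ) {D : Set M.toStarSubalgebra} {q : M.toStarSubalgebra}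
    (hD : D.Nonempty) (hsa : ∀ c ∈ D, IsSelfAdjoint c) (hdir : DirectedOn (· ≤ ·) D)
    (hq : ∀ c ∈ D, c ≤ q)
    (h : ∀ x, ∀ ε > 0, ∃ c ∈ D, (inner ℂ (q.1 x) x).re - ε ≤ (inner ℂ (c.1 x) x).re)
    {r : ℝ} (hr : ∀ c ∈ D, (τ c).re ≤ r) : (τ q).re ≤ r := by
  refine (hτ.normal D q hsa hD hdir (isLUB_of_inner_approx hD hq h)).2 ?_
  rintro _ ⟨c, hc, rfl⟩
  exact hr c hc

/-! ### Countable subadditivity of the trace on projections -/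

/-- For `y = t (p k x)`, pairing `y + n ∑ p_i y = p_k x` with `y` gives `‖y‖² + n ∑ ‖p_i y‖² ≤ ‖p_k
x‖ ‖p_k y‖`. The first bound yields `n p_k t p_k ≤ p_k`; the second makes `t` tend to `0` on the
range of `p_k`. -/
theorem inner_resolvent_le {ι : Type*} {s : Finset ι} {p : ι → H →L[ℂ] H}
    (hp : ∀ i ∈ s, IsStarProjection (p i)) {n : ℝ} (hn : 0 ≤ n) {t : H →L[ℂ] H}
    (ht : (1 + (n : ℂ) • ∑ i ∈ s, p i) * t = 1) {k : ι} (hk : k ∈ s) (x : H) :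
    n * ‖p k (t (p k x))‖ ≤ ‖p k x‖ ∧ n * ‖t (p k x)‖ ^ 2 ≤ ‖p k x‖ ^ 2 := by
  set y := t (p k x) with hy
  have h1 : y + (n : ℂ) • ∑ i ∈ s, p i y = p k x := by
    have := congrArg (fun a : H →L[ℂ] H => a (p k x)) ht
    simpa [sum_apply] using this
  have h2 : ‖y‖ ^ 2 + n * ∑ i ∈ s, ‖p i y‖ ^ 2 = (inner ℂ (p k x) y).re := by
    rw [← h1, inner_add_left, inner_smul_left, sum_inner,
      Finset.sum_congr rfl fun i hi => inner_proj_self_left (hp i hi) y,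
      inner_self_eq_norm_sq_to_K, ← Complex.ofReal_sum]
    simp [← Complex.ofReal_pow]
  have h3 : (inner ℂ (p k x) y).re ≤ ‖p k x‖ * ‖p k y‖ := by
    have : inner ℂ (p k x) y = inner ℂ (p k x) (p k y) := by
      rw [← inner_proj (hp k hk), proj_apply_apply (hp k hk)]
    rw [this]
    exact (Complex.re_le_norm _).trans (norm_inner_le_norm _ _)
  have h4 : ‖p k y‖ ^ 2 ≤ ∑ i ∈ s, ‖p i y‖ ^ 2 :=
    Finset.single_le_sum (f := fun i => ‖p i y‖ ^ 2) (fun i _ => sq_nonneg _) hk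
  have h5 : ‖y‖ ^ 2 + n * ‖p k y‖ ^ 2 ≤ ‖p k x‖ * ‖p k y‖ := by
    have := mul_le_mul_of_nonneg_left h4 hn
    linarith
  have h6 : n * ‖p k y‖ ≤ ‖p k x‖ := by
    rcases (norm_nonneg (p k y)).eq_or_lt with h | h
    · rw [← h]; simp
    · refine le_of_mul_le_mul_right ?_ h
      nlinarith [sq_nonneg ‖y‖]
  refine ⟨h6, ?_⟩
  have h7 : ‖y‖ ^ 2 ≤ ‖p k x‖ * ‖p k y‖ := by
    have := mul_nonneg hn (sq_nonneg ‖p k y‖)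
    linarith
  calc n * ‖y‖ ^ 2 ≤ n * (‖p k x‖ * ‖p k y‖) := mul_le_mul_of_nonneg_left h7 hn
    _ = ‖p k x‖ * (n * ‖p k y‖) := by ring
    _ ≤ ‖p k x‖ * ‖p k x‖ := mul_le_mul_of_nonneg_left h6 (norm_nonneg _)
    _ = ‖p k x‖ ^ 2 := by ring

theorem inv_mem {a : (H →L[ℂ] H)ˣ} (ha : (a : H →L[ℂ] H) ∈ M.toStarSubalgebra) :
    ((a⁻¹ : (H →L[ℂ] H)ˣ) : H →L[ℂ] H) ∈ M.toStarSubalgebra := by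
  refine mem_of_commute _ fun c hc => ?_
  have : Commute c (a : H →L[ℂ] H) := commute_of_mem ha hc
  exact this.units_inv_right

/-- Countable subadditivity of the trace on the lattice of projections. -/
theorem IsFaithfulNormalTracialState.re_join_le (hτ : IsFaithfulNormalTracialState M τ)
    {p : ℕ → M.toStarSubalgebra} (hp : ∀ i, IsStarProjection (p i)) {q : M.toStarSubalgebra}
    (hq : IsStarProjection q) (hpq : ∀ i x, q.1 ((p i).1 x) = (p i).1 x)
    (hmin : ∀ K : Submodule ℂ H, IsClosed (K : Set H) → (∀ i x, (p i).1 x ∈ K) → ∀ x, q.1 x ∈ K)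
    {r : ℝ} (hr : ∀ N, ∑ i ∈ Finset.range N, (τ (p i)).re ≤ r) : (τ q).re ≤ r := by
  have hp' := fun i => coe_isStarProjection (hp i)
  have hq' := coe_isStarProjection hq
  -- The factor `N` drives the resolvent of `S N` to `0` on every range, whatever the spectrum of
  -- the sum.
  let S : ℕ → M.toStarSubalgebra := fun N => (N : ℂ) • ∑ i ∈ Finset.range N, p i
  have hScoe : ∀ N, (S N : H →L[ℂ] H) = ((N : ℝ) : ℂ) • ∑ i ∈ Finset.range N, (p i).1 := fun N => by
    simp [S]
  have hSmono : Monotone S := by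
    refine monotone_nat_of_le_succ fun N => ?_
    change (S N).1 ≤ (S (N + 1)).1
    rw [le_iff_inner]
    intro x
    have e : ∀ N, inner ℂ ((S N).1 x) x
        = (((N : ℝ) * ∑ i ∈ Finset.range N, ‖(p i).1 x‖ ^ 2 : ℝ) : ℂ) := fun N => by
      rw [hScoe]
      simp only [smul_apply, sum_apply, inner_smul_left,
        sum_inner, inner_proj_self_left (hp' _)]
      simp
    rw [e, e, Complex.real_le_real, Finset.sum_range_succ]
    push_cast
    have : 0 ≤ ∑ i ∈ Finset.range N, ‖(p i).1 x‖ ^ 2 := Finset.sum_nonneg fun _ _ => sq_nonneg _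
    have hN : (0 : ℝ) ≤ N := Nat.cast_nonneg N
    nlinarith [sq_nonneg ‖(p N).1 x‖, mul_nonneg hN (sq_nonneg ‖(p N).1 x‖)]
  have hS0 : ∀ N, 0 ≤ (S N).1 := fun N => by
    have h : (S 0).1 ≤ (S N).1 := hSmono (Nat.zero_le N)
    have e : (S 0).1 = 0 := by simp [S]
    rwa [e] at h
  have hone : IsStrictlyPositive (1 : H →L[ℂ] H) := isStrictlyPositive_one
  have hunit : ∀ N, ∃ a : (H →L[ℂ] H)ˣ, (a : H →L[ℂ] H) = 1 + (S N).1 := fun N =>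
    CStarAlgebra.isUnit_of_le 1 (le_add_of_nonneg_right (hS0 N)) hone
  choose a ha using hunit
  let t : ℕ → M.toStarSubalgebra := fun N => ⟨_, inv_mem (a := a N) (by
    rw [ha]; exact add_mem (one_mem _) (S N).2)⟩
  have hta : ∀ N, (1 + (S N).1) * (t N).1 = 1 := fun N => by
    rw [← ha]; exact (a N).mul_inv
  have ha0 : ∀ N, 0 ≤ (a N : H →L[ℂ] H) := fun N => by
    rw [ha]; exact add_nonneg zero_le_one (hS0 N)
  have htanti : Antitone t := fun m n hmn => by
    refine CStarAlgebra.inv_le_inv (ha0 m) ?_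
    rw [ha, ha]
    have h : (S m).1 ≤ (S n).1 := hSmono hmn
    gcongr
  have ht0 : ∀ N, 0 ≤ (t N).1 := fun N => CFC.inv_nonneg_of_nonneg (a N) (ha0 N)
  have ht1 : ∀ N, (t N).1 ≤ 1 := fun N => by
    have := htanti (Nat.zero_le N)
    have e : (t 0).1 = 1 := by simpa [S] using hta 0
    rw [← e]; exact this
  have htsa : ∀ N, IsSelfAdjoint (t N) := fun N => Subtype.ext (ht0 N).isSelfAdjoint
  have htn : ∀ N, ‖(t N).1‖ ≤ 1 := fun N => by
    rw [CStarAlgebra.norm_le_one_iff_of_nonneg _ (ht0 N)]; exact ht1 N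
  have hST : ∀ N, 1 - t N = S N * t N := fun N => by
    have : (1 + S N) * t N = 1 := Subtype.ext (hta N)
    rw [← this]; noncomm_ring
  have hqS : ∀ N, q * S N = S N := fun N => by
    have : ∀ i, q * p i = p i := fun i => Subtype.ext (ContinuousLinearMap.ext fun x => hpq i x)
    simp [S, Finset.mul_sum, this]
  have hqY : ∀ N, q * (1 - t N) * q = 1 - t N := fun N => by
    have h1 : q * (1 - t N) = 1 - t N := by rw [hST, ← mul_assoc, hqS]
    have h2 : (1 - t N) * q = 1 - t N := by
      have := congrArg star h1
      rwa [star_mul, star_sub, star_one, (htsa N).star_eq, hq.isSelfAdjoint.star_eq] at this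
    rw [h1, h2]
  have hY : ∀ N x, inner ℂ ((1 - t N).1 x) x
      = (‖q.1 x‖ ^ 2 : ℝ) - inner ℂ ((t N).1 (q.1 x)) (q.1 x) := fun N x => by
    rw [← hqY N]
    change inner ℂ (q.1 ((1 - (t N).1) (q.1 x))) x = _
    rw [inner_proj hq', sub_apply, inner_sub_left]
    simp [inner_self_eq_norm_sq_to_K]
  -- As the `t N` are contractions, the vectors they send to `0` in the limit form a closed
  -- subspace; it contains each range of `p i`, hence that of `q`.
  have hlim : ∀ x, Filter.Tendsto (fun N => (t N).1 (q.1 x)) Filter.atTop (𝓝 0) := by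
    let K : Submodule ℂ H :=
      { carrier := {y | Filter.Tendsto (fun N => (t N).1 y) Filter.atTop (𝓝 0)}
        add_mem' := fun {y z} hy hz => by simpa using Filter.Tendsto.add hy hz
        zero_mem' := by simp
        smul_mem' := fun c y hy => by simpa using Filter.Tendsto.const_smul hy c }
    refine hmin K ?_ ?_
    · refine isClosed_of_closure_subset fun y hy => ?_
      change Filter.Tendsto _ _ _
      rw [Metric.tendsto_atTop]
      intro ε hε
      obtain ⟨z, hz, hyz⟩ := Metric.mem_closure_iff.1 hy (ε / 2) (half_pos hε)
      obtain ⟨N, hN⟩ := (Metric.tendsto_atTop.1 hz) (ε / 2) (half_pos hε)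
      refine ⟨N, fun n hn => ?_⟩
      have h1 := hN n hn
      rw [dist_zero_right] at h1 ⊢
      have h2 : ‖(t n).1 (y - z)‖ ≤ ‖y - z‖ := by
        simpa using (t n).1.le_of_opNorm_le (htn n) (y - z)
      rw [dist_eq_norm] at hyz
      calc ‖(t n).1 y‖ = ‖(t n).1 (y - z) + (t n).1 z‖ := by rw [← map_add]; simp
        _ ≤ ‖(t n).1 (y - z)‖ + ‖(t n).1 z‖ := norm_add_le _ _
        _ < ε := by linarith
    · intro i x
      change Filter.Tendsto _ _ _
      have hsq : Filter.Tendsto (fun N : ℕ => ‖(t N).1 ((p i).1 x)‖ ^ 2) Filter.atTop (𝓝 0) := by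
        refine squeeze_zero' (g := fun N : ℕ => ‖(p i).1 x‖ ^ 2 / (N : ℝ))
          (Filter.Eventually.of_forall fun _ => sq_nonneg _) ?_
          (tendsto_const_div_atTop_nhds_zero_nat _)
        filter_upwards [Filter.eventually_gt_atTop i] with N hN
        have hN0 : (0 : ℝ) < N := by exact_mod_cast (Nat.zero_le i).trans_lt hN
        rw [le_div_iff₀ hN0, mul_comm]
        exact (inner_resolvent_le (fun i _ => hp' i) hN0.le (by rw [← hScoe]; exact hta N)
          (Finset.mem_range.2 hN) x).2
      rw [tendsto_zero_iff_norm_tendsto_zero]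
      have := hsq.sqrt
      simpa using this
  refine hτ.re_le_of_inner_approx (D := Set.range fun N => 1 - t N) (Set.range_nonempty _)
    ?_ ?_ ?_ ?_ ?_
  · rintro _ ⟨N, rfl⟩
    exact (IsSelfAdjoint.one _).sub (htsa N)
  · refine directedOn_range.2 (Monotone.directed_le fun m n hmn => ?_)
    exact sub_le_sub_left (show (t n).1 ≤ (t m).1 from htanti hmn) (1 : H →L[ℂ] H)
  · rintro _ ⟨N, rfl⟩
    change (1 - t N).1 ≤ q.1
    rw [le_iff_inner]
    intro x
    rw [hY, inner_proj_self_left hq']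
    exact sub_le_self _ ((nonneg_iff_inner _).1 (ht0 N) _)
  · intro x ε hε
    have h1 : Filter.Tendsto (fun N => (inner ℂ ((t N).1 (q.1 x)) (q.1 x)).re) Filter.atTop
        (𝓝 0) := by
      have := (Complex.continuous_re.tendsto _).comp
        ((hlim x).inner (tendsto_const_nhds (x := q.1 x)) (𝕜 := ℂ))
      simpa [Function.comp_def] using this
    obtain ⟨N, hN⟩ := (h1.eventually (gt_mem_nhds hε)).exists
    refine ⟨_, ⟨N, rfl⟩, ?_⟩
    dsimp only
    rw [hY, inner_proj_self_left hq', Complex.sub_re]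
    linarith
  · rintro _ ⟨N, rfl⟩
    refine le_trans ?_ (hr N)
    have e : 1 - t N = ∑ i ∈ Finset.range N, (N : ℂ) • (p i * t N) := by
      rw [hST]; simp [S, Finset.sum_mul, Finset.smul_sum]
    dsimp only
    rw [e, map_sum, Complex.re_sum]
    refine Finset.sum_le_sum fun i hi => ?_
    -- Traciality replaces `p i * t N` by a positive compression, to which the resolvent bound
    -- applies.
    have e2 : τ ((N : ℂ) • (p i * t N)) = τ ((N : ℂ) • (p i * t N * p i)) := by
      rw [map_smul, map_smul, hτ.tracial (p i * t N) (p i), ← mul_assoc,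
        hp i |>.isIdempotentElem.eq]
    rw [e2]
    refine hτ.re_mono ?_
    change (N : ℂ) • ((p i).1 * (t N).1 * (p i).1) ≤ (p i).1
    rw [le_iff_inner]
    intro x
    have h1 : (0 : ℂ) ≤ inner ℂ (((N : ℂ) • ((p i).1 * (t N).1 * (p i).1)) x) x := by
      have := (nonneg_iff_inner _).1 (ht0 N) ((p i).1 x)
      have h2 : inner ℂ (((N : ℂ) • ((p i).1 * (t N).1 * (p i).1)) x) x
          = (N : ℂ) * inner ℂ ((t N).1 ((p i).1 x)) ((p i).1 x) := by
        change inner ℂ ((N : ℂ) • (p i).1 ((t N).1 ((p i).1 x))) x = _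
        rw [inner_smul_left, inner_proj (hp' i)]
        simp
      rw [h2]
      exact mul_nonneg (Nat.cast_nonneg _) this
    refine Complex.le_def.2 ⟨?_, ?_⟩
    · rw [inner_proj_self_left (hp' i)]
      refine (Complex.re_le_norm _).trans ?_
      have h3 := (inner_resolvent_le (fun i _ => hp' i) N.cast_nonneg
        (by rw [← hScoe]; exact hta N) hi x).1
      change ‖inner ℂ ((N : ℂ) • (p i).1 ((t N).1 ((p i).1 x))) x‖ ≤ _
      rw [← proj_apply_apply (hp' i), inner_smul_left, inner_proj (hp' i), norm_mul]
      have h4 := norm_inner_le_norm (𝕜 := ℂ) ((p i).1 ((t N).1 ((p i).1 x))) ((p i).1 x)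
      simp only [map_natCast, Complex.norm_natCast, Complex.ofReal_re]
      calc _ ≤ (N : ℝ) * (‖(p i).1 ((t N).1 ((p i).1 x))‖ * ‖(p i).1 x‖) :=
            mul_le_mul_of_nonneg_left h4 (Nat.cast_nonneg _)
        _ = (N * ‖(p i).1 ((t N).1 ((p i).1 x))‖) * ‖(p i).1 x‖ := by ring
        _ ≤ ‖(p i).1 x‖ * ‖(p i).1 x‖ := mul_le_mul_of_nonneg_right h3 (norm_nonneg _)
        _ = _ := by ring
    · rw [inner_proj_self_left (hp' i), ← (Complex.nonneg_iff.1 h1).2, Complex.ofReal_im]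

/-! ### The measure balls as a base of neighbourhoods -/

theorem proj_le_iff {p q : M.toStarSubalgebra} (hp : IsStarProjection p)
    (hq : IsStarProjection q) : p ≤ q ↔ q * p = p := by
  refine ((coe_isStarProjection hp).le_iff_mul_eq_right (coe_isStarProjection hq)).trans ?_
  exact ⟨fun h => Subtype.ext h, fun h => congrArg Subtype.val h⟩

theorem proj_nonneg {p : M.toStarSubalgebra} (hp : IsStarProjection p) :
    0 ≤ (p : H →L[ℂ] H) :=
  (coe_isStarProjection hp).nonneg

theorem norm_proj_le_one {p : M.toStarSubalgebra} (hp : IsStarProjection p) : ‖p‖ ≤ 1 :=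
  (coe_isStarProjection hp).norm_le

theorem exists_join_two (hτ : IsFaithfulNormalTracialState M τ) {p q : M.toStarSubalgebra}
    (hp : IsStarProjection p) (hq : IsStarProjection q) :
    ∃ r : M.toStarSubalgebra, IsStarProjection r ∧ r * p = p ∧ r * q = q ∧
      (τ r).re ≤ (τ p).re + (τ q).re := by
  let f : ℕ → M.toStarSubalgebra := fun n => if n = 0 then p else if n = 1 then q else 0
  have hf : ∀ n, IsStarProjection (f n) := fun n => by
    dsimp only [f]
    split_ifs
    exacts [hp, hq, IsStarProjection.zero _]
  obtain ⟨r, hr, h1, h2⟩ := exists_join f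
  refine ⟨r, hr, Subtype.ext (ContinuousLinearMap.ext fun x => h1 0 x),
    Subtype.ext (ContinuousLinearMap.ext fun x => h1 1 x), hτ.re_join_le hf hr h1 h2 fun N => ?_⟩
  have hp0 := hτ.re_nonneg (proj_nonneg hp)
  have hq0 := hτ.re_nonneg (proj_nonneg hq)
  match N with
  | 0 => simpa using add_nonneg hp0 hq0
  | 1 => simpa [f] using hq0
  | N + 2 =>
    rw [Finset.sum_range_succ', Finset.sum_range_succ']
    simp [f, add_comm]

theorem norm_nonneg_of_mem_measureBall {A : M.toStarSubalgebra} {ε δ : ℝ}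
    (h : A ∈ measureBall M τ ε δ) : 0 ≤ ε := by
  obtain ⟨E, -, h, -⟩ := h
  exact (norm_nonneg _).trans h

/-- The meet of `E` and `F`, taken as the complement of the join of their complements, serves both
elements at once. -/
theorem add_mem_measureBall (hτ : IsFaithfulNormalTracialState M τ) {A B : M.toStarSubalgebra}
    {ε ε' δ δ' : ℝ} (hA : A ∈ measureBall M τ ε δ) (hB : B ∈ measureBall M τ ε' δ') :
    A + B ∈ measureBall M τ (ε + ε') (δ + δ') := by
  have hε := norm_nonneg_of_mem_measureBall hA
  have hε' := norm_nonneg_of_mem_measureBall hB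
  obtain ⟨E, hE, hAE, hδ⟩ := hA
  obtain ⟨F, hF, hBF, hδ'⟩ := hB
  obtain ⟨r, hr, h1, h2, h3⟩ := exists_join_two hτ hE.one_sub hF.one_sub
  have key : ∀ G : M.toStarSubalgebra, IsStarProjection G → r * (1 - G) = 1 - G →
      G * (1 - r) = 1 - r := by
    intro G hG h
    have h' := congrArg star h
    rw [star_mul, hr.isSelfAdjoint.star_eq, hG.one_sub.isSelfAdjoint.star_eq] at h'
    have : (1 - G) * (1 - r) = 0 := by rw [mul_sub, h', mul_one, sub_self]
    rw [sub_mul, one_mul, sub_eq_zero] at this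
    exact this.symm
  have bound : ∀ (X G : M.toStarSubalgebra) (c : ℝ), IsStarProjection G → r * (1 - G) = 1 - G →
      ‖X * G‖ ≤ c → ‖X * (1 - r)‖ ≤ c := by
    intro X G c hG h hc
    rw [← key G hG h, ← mul_assoc]
    calc ‖X * G * (1 - r)‖ ≤ ‖X * G‖ * ‖1 - r‖ := norm_mul_le _ _
      _ ≤ ‖X * G‖ * 1 := mul_le_mul_of_nonneg_left (norm_proj_le_one hr.one_sub) (norm_nonneg _)
      _ ≤ c := by rwa [mul_one]
  refine ⟨1 - r, hr.one_sub, ?_, ?_⟩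
  · rw [add_mul]
    exact (norm_add_le _ _).trans (add_le_add (bound A E ε hE h1 hAE) (bound B F ε' hF h2 hBF))
  · rw [sub_sub_cancel]
    linarith

theorem zero_mem_measureBall {ε δ : ℝ} (hε : 0 ≤ ε)
    (hδ : 0 ≤ δ) : (0 : M.toStarSubalgebra) ∈ measureBall M τ ε δ :=
  ⟨1, IsStarProjection.one _, by simpa using hε, by simpa using hδ⟩

/-- Not automatic, since the topology is given by its open sets. The points having a small ball
inside the given one form an open set, by halving both parameters. -/
theorem measureBall_mem_nhds (hτ : IsFaithfulNormalTracialState M τ) (A : M.toStarSubalgebra)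
    {ε δ : ℝ} (hε : 0 < ε) (hδ : 0 < δ) :
    {B | B - A ∈ measureBall M τ ε δ} ∈ @nhds _ (measureTopology M τ) A := by
  let _ := measureTopology M τ
  refine mem_nhds_iff.2 ⟨{B | ∃ ε' > 0, ∃ δ' > 0, ∀ C, C - B ∈ measureBall M τ ε' δ' →
    C - A ∈ measureBall M τ ε δ}, ?_, ?_, ⟨ε, hε, δ, hδ, fun _ h => h⟩⟩
  · rintro B ⟨ε', hε', δ', hδ', h⟩
    exact h B (by rw [sub_self]; exact zero_mem_measureBall (le_of_lt hε') (le_of_lt hδ'))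
  · rintro B ⟨ε', hε', δ', hδ', h⟩
    refine ⟨ε' / 2, half_pos hε', δ' / 2, half_pos hδ', fun C hC => ⟨ε' / 2, half_pos hε', δ' / 2,
      half_pos hδ', fun D hD => h D ?_⟩⟩
    have := add_mem_measureBall hτ hD hC
    rwa [sub_add_sub_cancel, add_halves, add_halves] at this

theorem mem_measure_nhds_iff (hτ : IsFaithfulNormalTracialState M τ) {A : M.toStarSubalgebra}
    {s : Set M.toStarSubalgebra} : s ∈ @nhds _ (measureTopology M τ) A ↔
      ∃ ε > 0, ∃ δ > 0, ∀ B, B - A ∈ measureBall M τ ε δ → B ∈ s := by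
  let _ := measureTopology M τ
  constructor
  · intro h
    obtain ⟨U, hUs, hU, hAU⟩ := mem_nhds_iff.1 h
    obtain ⟨ε, hε, δ, hδ, h⟩ := hU A hAU
    exact ⟨ε, hε, δ, hδ, fun B hB => hUs (h B hB)⟩
  · rintro ⟨ε, hε, δ, hδ, h⟩
    exact Filter.mem_of_superset (measureBall_mem_nhds hτ A hε hδ) h

/-! ### Projections of prescribed trace -/

/-- The least upper bound of a chain of projections, with the bound on its trace that normality
provides. -/
theorem exists_chain_sup (hτ : IsFaithfulNormalTracialState M τ) {D : Set M.toStarSubalgebra}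
    (hD : ∀ c ∈ D, IsStarProjection c) (hchain : IsChain (· ≤ ·) D) :
    ∃ q : M.toStarSubalgebra, IsStarProjection q ∧ (∀ c ∈ D, c ≤ q) ∧
      (∀ d, IsStarProjection d → (∀ c ∈ D, c ≤ d) → q ≤ d) ∧
      ∀ r : ℝ, 0 ≤ r → (∀ c ∈ D, (τ c).re ≤ r) → (τ q).re ≤ r := by
  obtain ⟨q, hq, hqc, hmin⟩ := exists_join (fun c : D => c.1)
  have hq' := coe_isStarProjection hq
  have hle : ∀ c ∈ D, c ≤ q := fun c hc => (proj_le_iff (hD c hc) hq).2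
    (Subtype.ext (ContinuousLinearMap.ext fun x => hqc ⟨c, hc⟩ x))
  refine ⟨q, hq, hle, fun d hd h => ?_, fun r hr0 hr => ?_⟩
  · rw [proj_le_iff hq hd]
    refine Subtype.ext (ContinuousLinearMap.ext fun x => ?_)
    refine hmin (LinearMap.eqLocus d.1.toLinearMap LinearMap.id) ?_ ?_ x
    · exact isClosed_eq d.1.continuous continuous_id
    · rintro ⟨c, hc⟩ x
      exact congrArg (fun a : M.toStarSubalgebra => a.1 x) ((proj_le_iff (hD c hc) hd).1 (h c hc))
  · rcases D.eq_empty_or_nonempty with rfl | hne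
    · have : q = 0 := Subtype.ext (ContinuousLinearMap.ext fun x =>
        (Submodule.mem_bot ℂ).1 (hmin ⊥ isClosed_singleton (fun i => i.2.elim) x))
      simpa [this] using hr0
    refine hτ.re_le_of_inner_approx hne (fun c hc => (hD c hc).isSelfAdjoint)
      hchain.directedOn hle (fun x ε hε => ?_) hr
    have : Nonempty D := hne.to_subtype
    let R : D → Submodule ℂ H := fun c => LinearMap.range c.1.1.toLinearMap
    have hdir : Directed (· ≤ ·) R := by
      rintro ⟨c, hc⟩ ⟨d, hd⟩
      have key : ∀ c d (hc : c ∈ D) (hd : d ∈ D), c ≤ d → R ⟨c, hc⟩ ≤ R ⟨d, hd⟩ := by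
        rintro c d hc hd h _ ⟨y, rfl⟩
        exact ⟨c.1 y, congrArg (fun a : M.toStarSubalgebra => a.1 y)
          ((proj_le_iff (hD c hc) (hD d hd)).1 h)⟩
      rcases hchain.total hc hd with h | h
      · exact ⟨⟨d, hd⟩, key c d hc hd h, le_rfl⟩
      · exact ⟨⟨c, hc⟩, le_rfl, key d c hd hc h⟩
    have hmem := hmin (⨆ c, R c).topologicalClosure (Submodule.isClosed_topologicalClosure _)
      (fun c y => Submodule.le_topologicalClosure _ (Submodule.mem_iSup_of_mem c ⟨y, rfl⟩)) x
    -- A distance at most `min 1 ε` has square at most `ε`. The ranges are directed, so the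
    -- approximating vector lies in the range of a single `c`.
    obtain ⟨y, hy, hyx⟩ := Metric.mem_closure_iff.1 hmem (min 1 ε) (lt_min one_pos hε)
    obtain ⟨c, z, rfl⟩ := (Submodule.mem_iSup_of_directed _ hdir).1 hy
    have hc := hD c c.2
    have hc' := coe_isStarProjection hc
    refine ⟨c, c.2, ?_⟩
    have hcq : q * c.1 = c := (proj_le_iff hc hq).1 (hle c c.2)
    have hqc' : c.1 * q = c := by
      have := congrArg star hcq
      rwa [star_mul, hc.isSelfAdjoint.star_eq, hq.isSelfAdjoint.star_eq] at this
    have hsub : IsStarProjection (q - c.1) := hc.sub_of_mul_eq_left hq hqc'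
    have h1 : ‖(q - c.1).1 x‖ ^ 2 = (inner ℂ (q.1 x) x).re - (inner ℂ (c.1.1 x) x).re := by
      have := congrArg Complex.re (inner_proj_self_left (coe_isStarProjection hsub) x)
      rw [Complex.ofReal_re] at this
      rw [← this]
      change (inner ℂ (q.1 x - c.1.1 x) x).re = _
      rw [inner_sub_left, Complex.sub_re]
    have h2 : (q - c.1).1 x = (1 - c.1).1 (q.1 x - c.1.1 z) := by
      change q.1 x - c.1.1 x = (q.1 x - c.1.1 z) - c.1.1 (q.1 x - c.1.1 z)
      have : c.1.1 (q.1 x) = c.1.1 x := congrArg (fun a : M.toStarSubalgebra => a.1 x) hqc'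
      rw [map_sub, this, proj_apply_apply hc']
      abel
    have h3 : ‖(q - c.1).1 x‖ ≤ min 1 ε := by
      rw [h2]
      refine (norm_proj_le (coe_isStarProjection hc.one_sub) _).trans ?_
      rw [← dist_eq_norm]
      exact hyx.le
    have h4 : ‖(q - c.1).1 x‖ ^ 2 ≤ ε := by
      have h5 := h3.trans (min_le_left _ _)
      have h6 := h3.trans (min_le_right _ _)
      nlinarith [norm_nonneg ((q - c.1).1 x)]
    linarith

/-- A maximal chain of projections in a von Neumann algebra without minimal projections contains a
projection of each trace between `0` and `1`. -/
theorem exists_projection_flow (hM : IsTypeII₁Factor M) (hτ : IsFaithfulNormalTracialState M τ) :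
    ∃ C : ℝ → M.toStarSubalgebra, ∀ t ∈ Set.Icc (0 : ℝ) 1, IsStarProjection (C t) ∧
      (τ (C t)).re = t ∧ ∀ s ∈ Set.Icc (0 : ℝ) 1, s ≤ t → C s ≤ C t := by
  let r : {p : M.toStarSubalgebra // IsStarProjection p} →
    {p : M.toStarSubalgebra // IsStarProjection p} → Prop := (· ≤ ·)
  let c : Set {p : M.toStarSubalgebra // IsStarProjection p} := maxChain r
  have hc : IsMaxChain r c := maxChain_spec
  have hmem : ∀ a : {p : M.toStarSubalgebra // IsStarProjection p},
      (∀ b ∈ c, a ≤ b ∨ b ≤ a) → a ∈ c := by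
    intro a ha
    have h1 : IsChain r (insert a c) := hc.1.insert fun b hb _ => ha b hb
    rw [hc.2 h1 (Set.subset_insert _ _)]
    exact Set.mem_insert _ _
  have htot : ∀ a ∈ c, ∀ b ∈ c, a.1 ≤ b.1 ∨ b.1 ≤ a.1 := fun a ha b hb => hc.1.total ha hb
  have hlow : ∀ a ∈ c, ∀ b ∈ c, (τ a.1).re < (τ b.1).re → a.1 ≤ b.1 := fun a ha b hb h =>
    (htot a ha b hb).resolve_right fun h' => (hτ.re_mono h').not_gt h
  have key : ∀ t ∈ Set.Icc (0 : ℝ) 1, ∃ a ∈ c, (τ a.1).re = t := by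
    rintro t ⟨ht0, ht1⟩
    by_contra! hne
    -- If trace `t` is missed, `q₀` is the supremum of the part of the chain below `t` and `1 - q₁`
    -- the infimum of the part above.
    obtain ⟨q₀, hq₀, hub₀, hlub₀, hτ₀⟩ := exists_chain_sup hτ
      (D := Subtype.val '' {a ∈ c | (τ a.1).re ≤ t}) (by rintro _ ⟨a, -, rfl⟩; exact a.2)
      (by rintro _ ⟨a, ha, rfl⟩ _ ⟨b, hb, rfl⟩ _; exact htot a ha.1 b hb.1)
    obtain ⟨q₁, hq₁, hub₁, hlub₁, hτ₁⟩ := exists_chain_sup hτ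
      (D := (fun a => 1 - Subtype.val a) '' {a ∈ c | t ≤ (τ a.1).re})
      (by rintro _ ⟨a, -, rfl⟩; exact a.2.one_sub)
      (by
        rintro _ ⟨a, ha, rfl⟩ _ ⟨b, hb, rfl⟩ _
        exact (htot b hb.1 a ha.1).imp (fun h => sub_le_sub_left (α := H →L[ℂ] H) h 1)
          (fun h => sub_le_sub_left (α := H →L[ℂ] H) h 1))
    have hup₀ : ∀ a ∈ c, t ≤ (τ a.1).re → q₀ ≤ a.1 := by
      intro a ha hta
      refine hlub₀ a a.2 ?_
      rintro _ ⟨b, ⟨hb, hbt⟩, rfl⟩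
      exact hlow b hb a ha (lt_of_le_of_lt hbt (lt_of_le_of_ne hta (Ne.symm (hne a ha))))
    have hdn₀ : ∀ a ∈ c, (τ a.1).re ≤ t → a.1 ≤ q₀ := fun a ha h => hub₀ _ ⟨a, ⟨ha, h⟩, rfl⟩
    have hup₁ : ∀ a ∈ c, t ≤ (τ a.1).re → 1 - q₁ ≤ a.1 := fun a ha h => by
      have : (1 - a.1).1 ≤ q₁.1 := hub₁ _ ⟨a, ⟨ha, h⟩, rfl⟩
      change 1 - q₁.1 ≤ a.1.1
      exact sub_le_comm.1 this
    have hdn₁ : ∀ a ∈ c, (τ a.1).re ≤ t → a.1 ≤ 1 - q₁ := by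
      intro a ha hta
      have : q₁.1 ≤ (1 - a.1).1 := by
        refine hlub₁ (1 - a.1) a.2.one_sub ?_
        rintro _ ⟨b, ⟨hb, hbt⟩, rfl⟩
        have : a.1.1 ≤ b.1.1 :=
          hlow a ha b hb (lt_of_lt_of_le (lt_of_le_of_ne hta (hne a ha)) hbt)
        exact sub_le_sub_left (α := H →L[ℂ] H) this 1
      change a.1.1 ≤ 1 - q₁.1
      exact le_sub_comm.1 this
    -- A projection in the gap is comparable with the whole chain, so maximality puts it in the
    -- chain.
    have hmid : ∀ d, IsStarProjection d → q₀ ≤ d → d ≤ 1 - q₁ →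
        ∃ h : IsStarProjection d, (⟨d, h⟩ : {p : M.toStarSubalgebra // IsStarProjection p}) ∈ c := by
      intro d hd h0 h1
      refine ⟨hd, hmem _ fun b hb => ?_⟩
      rcases le_total (τ b.1).re t with h | h
      · exact Or.inr ((hdn₀ b hb h).trans h0)
      · exact Or.inl (h1.trans (hup₁ b hb h))
    have h01 : q₀ ≤ 1 - q₁ := by
      refine hlub₀ _ hq₁.one_sub ?_
      rintro _ ⟨b, ⟨hb, hbt⟩, rfl⟩
      exact hdn₁ b hb hbt
    have ht₀ : (τ q₀).re ≤ t := hτ₀ t ht0 (by rintro _ ⟨a, ⟨-, h⟩, rfl⟩; exact h)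
    have ht₁ : (τ q₁).re ≤ 1 - t := hτ₁ (1 - t) (by linarith) (by
      rintro _ ⟨a, ⟨-, h⟩, rfl⟩
      simp only [map_sub, hτ.map_one, Complex.sub_re, Complex.one_re]
      linarith [h])
    obtain ⟨hq0', hq₀c⟩ := hmid q₀ hq₀ le_rfl h01
    have hlt₀ : (τ q₀).re < t := lt_of_le_of_ne ht₀ (hne _ hq₀c)
    have hqq : (1 - q₁) * q₀ = q₀ := (proj_le_iff hq₀ hq₁.one_sub).1 h01
    have hqq' : q₀ * (1 - q₁) = q₀ := by
      have := congrArg star hqq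
      rwa [star_mul, hq₁.one_sub.isSelfAdjoint.star_eq, hq₀.isSelfAdjoint.star_eq] at this
    have hg : IsStarProjection (1 - q₁ - q₀) := hq₀.sub_of_mul_eq_left hq₁.one_sub hqq'
    have hg0 : 1 - q₁ - q₀ ≠ 0 := by
      intro h
      have := congrArg (fun a => (τ a).re) h
      simp [hτ.map_one] at this
      linarith
    obtain ⟨s, hsM, hs, hsg, hs0, hsne⟩ := hM.no_minimal_projection (1 - q₁ - q₀).1
      (1 - q₁ - q₀).2 (coe_isStarProjection hg) (fun h => hg0 (Subtype.ext h))
    let s' : M.toStarSubalgebra := ⟨s, hsM⟩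
    have hs' : IsStarProjection s' := isStarProjection_of_coe hs
    have hgs : (1 - q₁ - q₀) * s' = s' := (proj_le_iff hs' hg).1 hsg
    have hq0s : q₀ * s' = 0 := by
      rw [← hgs, ← mul_assoc, mul_sub, hqq', hq₀.isIdempotentElem.eq, sub_self, zero_mul]
    have hd : IsStarProjection (q₀ + s') := hq₀.add hs' hq0s
    have hd0 : q₀ ≤ q₀ + s' := le_add_of_nonneg_right (α := H →L[ℂ] H) hs.nonneg
    have hd1 : q₀ + s' ≤ 1 - q₁ := by
      have := add_le_add_right (α := H →L[ℂ] H) hsg q₀.1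
      change q₀.1 + s ≤ 1 - q₁.1
      convert this using 1
      change _ = q₀.1 + (1 - q₁.1 - q₀.1)
      abel
    obtain ⟨hd', hdc⟩ := hmid _ hd hd0 hd1
    -- Being in the chain, `q₀ + s'` is below `q₀` or above `1 - q₁`, so `s` is zero or the whole
    -- gap, against its choice.
    rcases le_total (τ (q₀ + s')).re t with h | h
    · have h1 : q₀.1 + s ≤ q₀.1 := hdn₀ _ hdc h
      exact hs0 (le_antisymm (by simpa using h1) hs.nonneg)
    · have h1 : 1 - q₁.1 ≤ q₀.1 + s := hup₁ _ hdc h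
      refine hsne (le_antisymm hsg ?_)
      change 1 - q₁.1 - q₀.1 ≤ s
      exact sub_le_iff_le_add'.2 h1
  have : Nonempty {p : M.toStarSubalgebra // IsStarProjection p} := ⟨0, IsStarProjection.zero _⟩
  choose! C hCc hCt using key
  refine ⟨fun t => (C t).1, fun t ht => ⟨(C t).2, hCt t ht, fun s hs hst => ?_⟩⟩
  rcases hst.eq_or_lt with rfl | hlt
  · exact le_rfl
  · exact hlow _ (hCc s hs) _ (hCc t ht) (by rwa [hCt s hs, hCt t ht])

theorem IsFaithfulNormalTracialState.eq_zero_of_re_le_zero (hτ : IsFaithfulNormalTracialState M τ)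
    {p : M.toStarSubalgebra} (hp : IsStarProjection p) (h : (τ p).re ≤ 0) : p = 0 := by
  refine hτ.faithful p ?_
  rw [hp.isSelfAdjoint.star_eq, hp.isIdempotentElem.eq]
  have := Complex.nonneg_iff.1 (hτ.apply_nonneg (proj_nonneg hp))
  exact Complex.ext (le_antisymm h this.1) this.2.symm

/-- In a `II₁` factor the identity is a sum of `N` projections of trace `1 / N`. -/
theorem exists_partition (hM : IsTypeII₁Factor M) (hτ : IsFaithfulNormalTracialState M τ) {N : ℕ}
    (hN : 0 < N) : ∃ P : Fin N → M.toStarSubalgebra, (∀ i, IsStarProjection (P i)) ∧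
      (∀ i, (τ (P i)).re = 1 / N) ∧ (∀ i j, i ≠ j → P i * P j = 0) ∧ ∑ i, P i = 1 := by
  obtain ⟨C, hC⟩ := exists_projection_flow hM hτ
  have hN' : (0 : ℝ) < N := Nat.cast_pos.2 hN
  let D : ℕ → M.toStarSubalgebra := fun i => C (i / N)
  have hIcc : ∀ i ≤ N, (i / N : ℝ) ∈ Set.Icc (0 : ℝ) 1 := fun i hi =>
    ⟨by positivity, (div_le_one hN').2 (Nat.cast_le.2 hi)⟩
  have hD : ∀ i ≤ N, IsStarProjection (D i) := fun i hi => (hC _ (hIcc i hi)).1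
  have hDτ : ∀ i ≤ N, (τ (D i)).re = i / N := fun i hi => (hC _ (hIcc i hi)).2.1
  have hDmul : ∀ i j, i ≤ j → j ≤ N → D j * D i = D i := fun i j hij hj =>
    (proj_le_iff (hD i (hij.trans hj)) (hD j hj)).1 ((hC _ (hIcc j hj)).2.2 _
      (hIcc i (hij.trans hj)) (div_le_div_of_nonneg_right (Nat.cast_le.2 hij) hN'.le))
  have hDmul' : ∀ i j, i ≤ j → j ≤ N → D i * D j = D i := fun i j hij hj => by
    have := congrArg star (hDmul i j hij hj)
    rwa [star_mul, (hD j hj).isSelfAdjoint.star_eq,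
      (hD i (hij.trans hj)).isSelfAdjoint.star_eq] at this
  have hD0 : D 0 = 0 := hτ.eq_zero_of_re_le_zero (hD 0 hN.le) (by simp [hDτ 0 hN.le])
  have hDN : D N = 1 := by
    have := hτ.eq_zero_of_re_le_zero (hD N le_rfl).one_sub
      (by simp [hDτ N le_rfl, hτ.map_one, hN'.ne'])
    exact (sub_eq_zero.1 this).symm
  refine ⟨fun i => D (i + 1) - D i, fun i => ?_, fun i => ?_, fun i j hij => ?_, ?_⟩
  · exact (hD i i.2.le).sub_of_mul_eq_left (hD (i + 1) i.2) (hDmul' i (i + 1) (Nat.le_succ _) i.2)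
  · rw [map_sub, Complex.sub_re, hDτ _ i.2, hDτ _ i.2.le]
    push_cast
    ring
  · have hi := i.2
    have hj := j.2
    rcases lt_or_gt_of_ne (fun h => hij (Fin.ext h) : (i : ℕ) ≠ j) with h | h
    · simp only [sub_mul, mul_sub]
      rw [hDmul' (i + 1) (j + 1) (by omega) (by omega), hDmul' (i + 1) j (by omega) (by omega),
        hDmul' i (j + 1) (by omega) (by omega), hDmul' i j (by omega) (by omega)]
      simp
    · simp only [sub_mul, mul_sub]
      rw [hDmul (j + 1) (i + 1) (by omega) (by omega), hDmul j (i + 1) (by omega) (by omega),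
        hDmul (j + 1) i (by omega) (by omega), hDmul j i (by omega) (by omega)]
      simp
  · rw [Fin.sum_univ_eq_sum_range (fun i => D (i + 1) - D i), Finset.sum_range_sub, hD0, hDN,
      sub_zero]

/-! ### Large common zeros of finitely many functionals -/

/-- A point of the cube in the kernel of `L` with the largest possible norm has few coordinates
that are not `1` or `-1`. -/
theorem exists_cube_kernel {n : ℕ} {V : Type*} [AddCommGroup V] [Module ℝ V]
    [TopologicalSpace V] [IsTopologicalAddGroup V] [ContinuousSMul ℝ V] [T2Space V]
    [FiniteDimensional ℝ V] (L : (Fin n → ℝ) →ₗ[ℝ] V) :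
    ∃ c : Fin n → ℝ, (∀ i, c i ^ 2 ≤ 1) ∧ L c = 0 ∧
      (n : ℝ) ≤ ∑ i, c i ^ 2 + Module.finrank ℝ V := by
  classical
  let K : Set (Fin n → ℝ) := Set.Icc (-1) 1 ∩ {c | L c = 0}
  have hK : IsCompact K := isCompact_Icc.inter_right
    (isClosed_eq L.continuous_of_finiteDimensional continuous_const)
  have hne : K.Nonempty := ⟨0, ⟨fun i => by simp, fun i => by simp⟩, by simp⟩
  obtain ⟨c, ⟨hc1, hcL⟩, hmax⟩ := hK.exists_isMaxOn hne
    (f := fun c => ∑ i, c i ^ 2) (by fun_prop)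
  have hsq : ∀ i, c i ^ 2 ≤ 1 := fun i => by
    have h1 := hc1.1 i
    have h2 := hc1.2 i
    simp only [Pi.neg_apply, Pi.one_apply] at h1 h2
    nlinarith
  refine ⟨c, hsq, hcL, ?_⟩
  let Z : Finset (Fin n) := Finset.univ.filter fun i => c i ^ 2 < 1
  -- With more free coordinates than `dim V`, some nonzero `v` in the kernel is supported on them.
  -- Both `c ± t v` stay in the cube for small `t`, and by the parallelogram law one of them is
  -- longer than `c`.
  have hZ : Z.card ≤ Module.finrank ℝ V := by
    by_contra! hlt
    let L' : (Fin n → ℝ) →ₗ[ℝ] V × ({i // i ∉ Z} → ℝ) :=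
      L.prod (LinearMap.funLeft ℝ ℝ Subtype.val)
    have hrank : Module.finrank ℝ (V × ({i // i ∉ Z} → ℝ)) < Module.finrank ℝ (Fin n → ℝ) := by
      have hcard : Fintype.card {i // i ∉ Z} = n - Z.card := by
        rw [Fintype.card_subtype_compl]; simp
      have hZn : Z.card ≤ n := by simpa using Finset.card_le_univ Z
      rw [Module.finrank_prod, Module.finrank_fintype_fun_eq_card,
        Module.finrank_fintype_fun_eq_card, hcard, Fintype.card_fin]
      omega
    obtain ⟨v, hv, hv0⟩ := Submodule.exists_mem_ne_zero_of_ne_bot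
      (LinearMap.ker_ne_bot_of_finrank_lt (f := L') hrank)
    have hv' : L' v = 0 := hv
    have hvL : L v = 0 := congrArg Prod.fst hv'
    have hvZ : ∀ i, i ∉ Z → v i = 0 := fun i hi => congrFun (congrArg Prod.snd hv') ⟨i, hi⟩
    have hev : ∀ᶠ t in 𝓝 (0 : ℝ), ∀ i, (c i + t * v i) ^ 2 ≤ 1 ∧ (c i - t * v i) ^ 2 ≤ 1 := by
      refine Filter.eventually_all.2 fun i => ?_
      by_cases hi : i ∈ Z
      · have hi' : c i ^ 2 < 1 := (Finset.mem_filter.1 hi).2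
        have h1 : Filter.Tendsto (fun t : ℝ => (c i + t * v i) ^ 2) (𝓝 0) (𝓝 (c i ^ 2)) :=
          Continuous.tendsto' (by fun_prop) _ _ (by simp)
        have h2 : Filter.Tendsto (fun t : ℝ => (c i - t * v i) ^ 2) (𝓝 0) (𝓝 (c i ^ 2)) :=
          Continuous.tendsto' (by fun_prop) _ _ (by simp)
        filter_upwards [h1.eventually (gt_mem_nhds hi'), h2.eventually (gt_mem_nhds hi')]
          with t ht1 ht2 using ⟨ht1.le, ht2.le⟩
      · simp [hvZ i hi, hsq i]
    obtain ⟨t, ht, ht0⟩ := ((hev.filter_mono nhdsWithin_le_nhds).and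
      (self_mem_nhdsWithin (s := Set.Ioi (0 : ℝ)))).exists
    have hcube : ∀ d : Fin n → ℝ, (∀ i, d i ^ 2 ≤ 1) → L d = 0 → d ∈ K := fun d hd hL =>
      ⟨⟨fun i => (abs_le.1 ((sq_le_one_iff_abs_le_one _).1 (hd i))).1,
        fun i => (abs_le.1 ((sq_le_one_iff_abs_le_one _).1 (hd i))).2⟩, hL⟩
    have h1 : ∑ i, (c + t • v) i ^ 2 ≤ ∑ i, c i ^ 2 :=
      hmax (hcube (c + t • v) (fun i => (ht i).1) (by simp [hvL, show L c = 0 from hcL]))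
    have h2 : ∑ i, (c - t • v) i ^ 2 ≤ ∑ i, c i ^ 2 :=
      hmax (hcube (c - t • v) (fun i => (ht i).2) (by simp [hvL, show L c = 0 from hcL]))
    have h3 : ∑ i, (c + t • v) i ^ 2 + ∑ i, (c - t • v) i ^ 2
        = 2 * ∑ i, c i ^ 2 + 2 * t ^ 2 * ∑ i, v i ^ 2 := by
      rw [Finset.mul_sum, Finset.mul_sum, ← Finset.sum_add_distrib, ← Finset.sum_add_distrib]
      refine Finset.sum_congr rfl fun i _ => ?_
      simp only [Pi.add_apply, Pi.sub_apply, Pi.smul_apply, smul_eq_mul]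
      ring
    have h4 : 0 < ∑ i, v i ^ 2 := by
      obtain ⟨i, hi⟩ := Function.ne_iff.1 hv0
      exact Finset.sum_pos' (fun _ _ => sq_nonneg _) ⟨i, Finset.mem_univ _, sq_pos_of_ne_zero hi⟩
    have h5 : 0 < 2 * t ^ 2 * ∑ i, v i ^ 2 := by
      have : 0 < t := ht0
      positivity
    linarith
  have hsum : ((Finset.univ \ Z).card : ℝ) ≤ ∑ i, c i ^ 2 := by
    calc ((Finset.univ \ Z).card : ℝ) = ∑ i ∈ Finset.univ \ Z, (1 : ℝ) := by simp
      _ ≤ ∑ i ∈ Finset.univ \ Z, c i ^ 2 := Finset.sum_le_sum fun i hi => by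
        have : ¬ c i ^ 2 < 1 := fun h =>
          (Finset.mem_sdiff.1 hi).2 (Finset.mem_filter.2 ⟨Finset.mem_univ _, h⟩)
        exact not_lt.1 this
      _ ≤ ∑ i, c i ^ 2 := Finset.sum_le_sum_of_subset_of_nonneg (Finset.subset_univ _)
        fun _ _ _ => sq_nonneg _
  have hcard : (n : ℝ) = (Finset.univ \ Z).card + Z.card := by
    rw [← Nat.cast_add, Finset.card_sdiff_add_card_eq_card (Finset.subset_univ _)]
    simp
  have : (Z.card : ℝ) ≤ Module.finrank ℝ V := Nat.cast_le.2 hZ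
  linarith

/-- Finitely many linear functionals on a `II₁` factor have a common zero in the unit ball that is
large in the `2`-norm of the trace. -/
theorem exists_common_zero (hM : IsTypeII₁Factor M) (hτ : IsFaithfulNormalTracialState M τ)
    (Φ : Finset (M.toStarSubalgebra →ₗ[ℂ] ℂ)) :
    ∃ A ∈ unitBall M, (∀ φ ∈ Φ, φ A = 0) ∧ 1 / 2 ≤ (τ (star A * A)).re := by
  -- The target `ℂ^Φ` has real dimension `2|Φ|`, so `τ(A*A) ≥ (N - 2|Φ|)/N`, which is at least `1/2`
  -- here; the `+ 1` keeps `N` positive.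
  let N := 4 * Φ.card + 1
  obtain ⟨P, hP, hPτ, hPorth, hPsum⟩ := exists_partition hM hτ (N := N) (Nat.succ_pos _)
  let T : (Fin N → ℝ) →ₗ[ℝ] M.toStarSubalgebra :=
    ∑ i, (LinearMap.proj i : (Fin N → ℝ) →ₗ[ℝ] ℝ).smulRight (P i)
  have hT : ∀ c, T c = ∑ i, (c i : ℂ) • P i := fun c => by
    simp [T, LinearMap.sum_apply]
  let L : (Fin N → ℝ) →ₗ[ℝ] (Φ → ℂ) := LinearMap.pi fun φ => (φ.1.restrictScalars ℝ) ∘ₗ T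
  obtain ⟨c, hc1, hcL, hcN⟩ := exists_cube_kernel L
  have hmul : star (T c) * T c = ∑ i, ((c i ^ 2 : ℝ) : ℂ) • P i := by
    rw [hT, star_sum, Finset.sum_mul]
    refine Finset.sum_congr rfl fun i _ => ?_
    rw [star_smul, (hP i).isSelfAdjoint.star_eq, Finset.mul_sum, Finset.sum_eq_single i]
    · rw [smul_mul_smul_comm, (hP i).isIdempotentElem.eq]
      simp [pow_two]
    · intro j _ hj
      rw [smul_mul_smul_comm, hPorth i j hj.symm, smul_zero]
    · simp
  refine ⟨T c, ?_, fun φ hφ => congrFun hcL ⟨φ, hφ⟩, ?_⟩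
  · have h1 : (star (T c) * T c).1 ≤ 1 := by
      rw [← show ((1 : M.toStarSubalgebra) : H →L[ℂ] H) = 1 from rfl, ← hPsum, hmul, le_iff_inner]
      intro x
      have e : ∀ d : Fin N → ℝ, inner ℂ ((∑ i, (d i : ℂ) • P i : M.toStarSubalgebra).1 x) x
          = ((∑ i, d i * ‖(P i).1 x‖ ^ 2 : ℝ) : ℂ) := fun d => by
        simp only [AddSubmonoidClass.coe_finsetSum, SetLike.val_smul, sum_apply, smul_apply,
          sum_inner, inner_smul_left, inner_proj_self_left (coe_isStarProjection (hP _))]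
        simp
      have e1 := e fun _ => 1
      simp only [Complex.ofReal_one, one_smul, one_mul] at e1
      rw [e, e1, Complex.real_le_real]
      exact Finset.sum_le_sum fun i _ => mul_le_of_le_one_left (sq_nonneg _) (hc1 i)
    have h0 : 0 ≤ (star (T c) * T c).1 := star_mul_self_nonneg (T c).1
    have h2 := (CStarAlgebra.norm_le_one_iff_of_nonneg _ h0).2 h1
    change ‖star (T c).1 * (T c).1‖ ≤ 1 at h2
    rw [CStarRing.norm_star_mul_self] at h2
    change ‖(T c).1‖ ≤ 1
    nlinarith [norm_nonneg (T c).1]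
  · have hτsum : (τ (star (T c) * T c)).re = (∑ i, c i ^ 2) / N := by
      rw [hmul, map_sum, Complex.re_sum, Finset.sum_div]
      refine Finset.sum_congr rfl fun i _ => ?_
      rw [map_smul, smul_eq_mul, Complex.re_ofReal_mul, hPτ]
      ring
    have hrank : Module.finrank ℝ (Φ → ℂ) = 2 * Φ.card := by
      rw [Module.finrank_pi_fintype]
      simp [Complex.finrank_real_complex, mul_comm]
    rw [hrank] at hcN
    have hNr : (N : ℝ) = 4 * Φ.card + 1 := by simp [N]
    rw [hτsum, le_div_iff₀ (by rw [hNr]; positivity)]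
    push_cast at hcN
    linarith

/-! ### Measure balls and the 2-norm -/

/-- By traciality the left side is the trace of `(Xp)*(Xp)`, which is dominated by `‖Xp‖² p`. -/
theorem IsFaithfulNormalTracialState.re_mul_proj_le (hτ : IsFaithfulNormalTracialState M τ)
    (X : M.toStarSubalgebra) {p : M.toStarSubalgebra} (hp : IsStarProjection p) :
    (τ (star X * X * p)).re ≤ ‖X * p‖ ^ 2 * (τ p).re := by
  have hp' := coe_isStarProjection hp
  have e : τ (star X * X * p) = τ (star (X * p) * (X * p)) := by
    rw [star_mul, hp.isSelfAdjoint.star_eq, mul_assoc p, hτ.tracial p]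
    simp only [mul_assoc, hp.isIdempotentElem.eq]
  have h : star (X * p) * (X * p) ≤ ((‖X * p‖ ^ 2 : ℝ) : ℂ) • p := by
    change star (X * p).1 * (X * p).1 ≤ ((‖X * p‖ ^ 2 : ℝ) : ℂ) • p.1
    rw [le_iff_inner]
    intro x
    change inner ℂ (star (X * p).1 ((X * p).1 x)) x ≤ inner ℂ (((‖X * p‖ ^ 2 : ℝ) : ℂ) • p.1 x) x
    rw [ContinuousLinearMap.star_eq_adjoint, ContinuousLinearMap.adjoint_inner_left,
      inner_smul_left, inner_proj_self_left hp', inner_self_eq_norm_sq_to_K, Complex.conj_ofReal]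
    have h1 : (X * p).1 x = (X * p).1 (p.1 x) := by
      change X.1 (p.1 x) = X.1 (p.1 (p.1 x))
      rw [proj_apply_apply hp']
    have h2 : ‖(X * p).1 x‖ ≤ ‖X * p‖ * ‖p.1 x‖ := by
      rw [h1]; exact (X * p).1.le_opNorm _
    have h3 : ‖(X * p).1 x‖ ^ 2 ≤ ‖X * p‖ ^ 2 * ‖p.1 x‖ ^ 2 := by
      rw [← mul_pow]; exact pow_le_pow_left₀ (norm_nonneg _) h2 2
    refine le_trans (le_of_eq ?_) ((Complex.real_le_real.2 h3).trans (le_of_eq ?_)) <;> simp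
  rw [e]
  refine (hτ.re_mono h).trans (le_of_eq ?_)
  rw [map_smul, smul_eq_mul, Complex.re_ofReal_mul]

/-- On bounded sets the measure topology controls the `2`-norm of the trace. -/
theorem re_star_mul_self_le (hτ : IsFaithfulNormalTracialState M τ) {X : M.toStarSubalgebra}
    {ε δ r : ℝ} (hX : X ∈ measureBall M τ ε δ) (hr : ‖X‖ ≤ r) :
    (τ (star X * X)).re ≤ ε ^ 2 + r ^ 2 * δ := by
  have hε := norm_nonneg_of_mem_measureBall hX
  obtain ⟨E, hE, h1, h2⟩ := hX
  have e : star X * X = star X * X * E + star X * X * (1 - E) := by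
    rw [← mul_add, add_sub_cancel, mul_one]
  have hE0 := hτ.re_nonneg (proj_nonneg hE)
  have hE1 := hτ.re_nonneg (proj_nonneg hE.one_sub)
  have hle : (τ E).re ≤ 1 := by
    simp only [map_sub, hτ.map_one, Complex.sub_re, Complex.one_re] at hE1
    linarith
  have h3 : ‖X * (1 - E)‖ ≤ r :=
    calc ‖X * (1 - E)‖ ≤ ‖X‖ * ‖1 - E‖ := norm_mul_le _ _
      _ ≤ ‖X‖ * 1 := mul_le_mul_of_nonneg_left (norm_proj_le_one hE.one_sub) (norm_nonneg _)
      _ ≤ r := by rwa [mul_one]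
  rw [e, map_add, Complex.add_re]
  refine add_le_add ((hτ.re_mul_proj_le X hE).trans ?_)
    ((hτ.re_mul_proj_le X hE.one_sub).trans ?_)
  · calc ‖X * E‖ ^ 2 * (τ E).re ≤ ‖X * E‖ ^ 2 * 1 := mul_le_mul_of_nonneg_left hle (sq_nonneg _)
      _ ≤ ε ^ 2 := by rw [mul_one]; exact pow_le_pow_left₀ (norm_nonneg _) h1 2
  · exact mul_le_mul (pow_le_pow_left₀ (norm_nonneg _) h3 2) h2 hE1 (sq_nonneg _)

/-! ### Comparison of topologies and discontinuity of the trace -/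

theorem normTopology_le_measureTopology : normTopology M ≤ measureTopology M τ := by
  intro U hU
  refine (Metric.isOpen_iff (α := M.toStarSubalgebra)).2 fun A hA => ?_
  obtain ⟨ε, hε, δ, hδ, h⟩ := hU A hA
  refine ⟨ε, hε, fun B hB => h B ⟨1, IsStarProjection.one _, ?_, ?_⟩⟩
  · rw [mul_one, ← dist_eq_norm]
    exact (Metric.mem_ball.1 hB).le
  · simpa using le_of_lt hδ

theorem exists_ultraweak_functional {x y : ℕ → H} (hx : Summable fun i => ‖x i‖ ^ 2)
    (hy : Summable fun i => ‖y i‖ ^ 2) : ∃ φ : M.toStarSubalgebra →ₗ[ℂ] ℂ,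
      ∀ A, φ A = ∑' i, inner ℂ (x i) ((A : H →L[ℂ] H) (y i)) := by
  have hs : ∀ A : M.toStarSubalgebra,
      Summable fun i => inner ℂ (x i) ((A : H →L[ℂ] H) (y i)) := fun A => by
    refine Summable.of_norm_bounded ((hx.add hy).mul_left ‖A.1‖) fun i => ?_
    have h1 := norm_inner_le_norm (𝕜 := ℂ) (x i) (A.1 (y i))
    have h2 := mul_le_mul_of_nonneg_left (A.1.le_opNorm (y i)) (norm_nonneg (x i))
    have h3 : ‖x i‖ * ‖y i‖ ≤ ‖x i‖ ^ 2 + ‖y i‖ ^ 2 := by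
      nlinarith [sq_nonneg (‖x i‖ - ‖y i‖), sq_nonneg ‖x i‖, sq_nonneg ‖y i‖]
    have h4 := mul_le_mul_of_nonneg_left h3 (norm_nonneg A.1)
    calc _ ≤ _ := h1
      _ ≤ _ := h2
      _ = ‖A.1‖ * (‖x i‖ * ‖y i‖) := by ring
      _ ≤ _ := h4
  refine ⟨{ toFun := fun A => ∑' i, inner ℂ (x i) ((A : H →L[ℂ] H) (y i)), map_add' := ?_,
            map_smul' := ?_ }, fun A => rfl⟩
  · intro A B
    rw [← (hs A).tsum_add (hs B)]
    simp
  · intro c A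
    rw [RingHom.id_apply, smul_eq_mul, ← tsum_mul_left]
    simp

/-- Each ultraweak neighbourhood of `0` contains the common kernel of finitely many functionals. -/
theorem exists_finset_of_mem_ultraweak_nhds {s : Set M.toStarSubalgebra}
    (hs : s ∈ @nhds _ (ultraweakTopology M) 0) :
    ∃ Φ : Finset (M.toStarSubalgebra →ₗ[ℂ] ℂ), ∀ A, (∀ φ ∈ Φ, φ A = 0) → A ∈ s := by
  have hle : (⨅ φ : M.toStarSubalgebra →ₗ[ℂ] ℂ, Filter.principal {A | φ A = 0})
      ≤ @nhds _ (ultraweakTopology M) 0 := by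
    simp only [nhds_iInf, nhds_induced, le_iInf_iff]
    intro x y hx hy
    obtain ⟨φ, hφ⟩ := exists_ultraweak_functional (M := M) hx hy
    refine (iInf_le _ φ).trans ?_
    rintro U ⟨V, hV, hVU⟩
    rw [Filter.mem_principal]
    intro A hA
    refine hVU (mem_of_mem_nhds ?_ : _ ∈ V)
    change V ∈ 𝓝 (∑' i, inner ℂ (x i) (A.1 (y i)))
    rw [← hφ, show φ A = φ 0 by rw [map_zero]; exact hA, hφ]
    exact hV
  obtain ⟨t, ht, hts⟩ := (Filter.hasBasis_iInf_principal_finite _).mem_iff.1 (hle hs)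
  refine ⟨ht.toFinset, fun A hA => hts ?_⟩
  rw [Set.mem_iInter₂]
  exact fun φ hφ => hA φ (ht.mem_toFinset.2 hφ)

theorem not_ultraweakTopology_le (hM : IsTypeII₁Factor M)
    (hτ : IsFaithfulNormalTracialState M τ) :
    ¬ ultraweakTopology M ≤ measureTopology M τ := by
  intro hle
  -- In the unit ball these parameters force `τ(A*A) ≤ 1/16 + 1/4 < 1/2`.
  have h1 := measureBall_mem_nhds hτ 0 (ε := 1 / 4) (δ := 1 / 4) (by norm_num) (by norm_num)
  obtain ⟨Φ, hΦ⟩ := exists_finset_of_mem_ultraweak_nhds (nhds_mono hle h1)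
  obtain ⟨A, hA, hA0, hA1⟩ := exists_common_zero hM hτ Φ
  have h2 : A - 0 ∈ measureBall M τ (1 / 4) (1 / 4) := hΦ A hA0
  rw [sub_zero] at h2
  have := re_star_mul_self_le hτ h2 (r := 1) hA
  norm_num at this
  linarith

theorem exists_small_proj (hM : IsTypeII₁Factor M) (hτ : IsFaithfulNormalTracialState M τ)
    {δ : ℝ} (hδ : 0 < δ) {x : H} (hx : x ≠ 0) : ∃ p : M.toStarSubalgebra, IsStarProjection p ∧
      (τ p).re ≤ δ ∧ p.1 x ≠ 0 := by
  obtain ⟨n, hn⟩ := exists_nat_one_div_lt hδ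
  obtain ⟨P, hP, hPτ, -, hsum⟩ := exists_partition hM hτ (N := n + 1) (Nat.succ_pos n)
  by_contra! h
  refine hx ?_
  have h1 : (∑ i, P i).1 x = x := by rw [hsum]; rfl
  rw [← h1, AddSubmonoidClass.coe_finsetSum, sum_apply]
  refine Finset.sum_eq_zero fun i _ => h (P i) (hP i) ?_
  rw [hPτ]
  push_cast
  exact hn.le

/-- The complement `1 - p` annihilates `c • p`, so the size of `c` is irrelevant. A functional
nonzero on `p` can thus be normalised to take the value `1` on a small element. -/
theorem smul_proj_mem_measureBall {p : M.toStarSubalgebra} (hp : IsStarProjection p) {ε δ : ℝ}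
    (hε : 0 ≤ ε) (hδ : (τ p).re ≤ δ) (c : ℂ) : c • p ∈ measureBall M τ ε δ := by
  refine ⟨1 - p, hp.one_sub, ?_, ?_⟩
  · rw [smul_mul_assoc, hp.mul_one_sub_self, smul_zero, norm_zero]
    exact hε
  · rwa [sub_sub_cancel]

theorem not_measureTopology_le (hM : IsTypeII₁Factor M) (hτ : IsFaithfulNormalTracialState M τ) :
    ¬ measureTopology M τ ≤ ultraweakTopology M := by
  intro hle
  have := hM.nontrivial
  obtain ⟨x, hx⟩ := exists_ne (0 : H)
  let X : ℕ → H := fun i => if i = 0 then x else 0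
  have hX : Summable fun i => ‖X i‖ ^ 2 :=
    summable_of_ne_finset_zero (s := {0}) fun i hi => by
      simp [X, show i ≠ 0 by simpa using hi]
  have hf : ∀ A : M.toStarSubalgebra,
      ∑' i, inner ℂ (X i) ((A : H →L[ℂ] H) (X i)) = inner ℂ x (A.1 x) := fun A => by
    rw [tsum_eq_single 0 fun i hi => by simp [X, hi]]
    simp [X]
  have hle' := hle.trans (iInf_le_of_le X <| iInf_le_of_le X <| iInf_le_of_le hX <|
    iInf_le_of_le hX le_rfl)
  obtain ⟨ε, hε, δ, hδ, h⟩ := hle' _ ⟨_, Metric.isOpen_ball (x := (0 : ℂ)) (ε := 1), rfl⟩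
    (0 : M.toStarSubalgebra) (by simp)
  obtain ⟨p, hp, hpδ, hpx⟩ := exists_small_proj hM hτ hδ hx
  have h1 := h ((inner ℂ x (p.1 x))⁻¹ • p) (by
    rw [sub_zero]; exact smul_proj_mem_measureBall hp (le_of_lt hε) hpδ _)
  have h2 : inner ℂ x (p.1 x) ≠ 0 := by
    rw [inner_proj_self (coe_isStarProjection hp)]
    exact_mod_cast (pow_pos (norm_pos_iff.2 hpx) 2).ne'
  rw [Set.mem_preimage, hf] at h1
  have h3 : inner ℂ x ((((inner ℂ x (p.1 x))⁻¹ • p : M.toStarSubalgebra)).1 x) = 1 := by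
    change inner ℂ x ((inner ℂ x (p.1 x))⁻¹ • p.1 x) = 1
    rw [inner_smul_right, inv_mul_cancel₀ h2]
  rw [h3] at h1
  simp at h1

theorem not_continuous_trace (hM : IsTypeII₁Factor M) (hτ : IsFaithfulNormalTracialState M τ) :
    ¬ Continuous[measureTopology M τ, inferInstance] τ := by
  intro hc
  have := hM.nontrivial
  obtain ⟨x, hx⟩ := exists_ne (0 : H)
  obtain ⟨ε, hε, δ, hδ, h⟩ := (@continuous_def _ _ (measureTopology M τ) _ _).1 hc _
    (Metric.isOpen_ball (x := (0 : ℂ)) (ε := 1)) (0 : M.toStarSubalgebra) (by simp)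
  obtain ⟨p, hp, hpδ, hpx⟩ := exists_small_proj hM hτ hδ hx
  have h1 := h ((τ p)⁻¹ • p) (by
    rw [sub_zero]; exact smul_proj_mem_measureBall hp (le_of_lt hε) hpδ _)
  have h2 : τ p ≠ 0 := fun h0 => hpx (by
    rw [hτ.eq_zero_of_re_le_zero hp (by rw [h0]; simp)]; rfl)
  rw [Set.mem_preimage, map_smul, smul_eq_mul, inv_mul_cancel₀ h2] at h1
  simp at h1

/-! ### The unit ball: continuity of the trace and failure of compactness -/

theorem norm_sub_le_two {A B : M.toStarSubalgebra} (hA : A ∈ unitBall M) (hB : B ∈ unitBall M) :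
    ‖A - B‖ ≤ 2 := by
  refine (norm_sub_le _ _).trans ?_
  have h1 : ‖A‖ ≤ 1 := hA
  have h2 : ‖B‖ ≤ 1 := hB
  linarith

theorem continuousOn_trace (hτ : IsFaithfulNormalTracialState M τ) :
    @ContinuousOn _ _ (measureTopology M τ) inferInstance τ (unitBall M) := by
  let _ := measureTopology M τ
  intro A hA
  refine Metric.tendsto_nhds.2 fun ε hε => ?_
  -- Differences in the unit ball have norm at most `2`, so the squared 2-norm is at most `ε²/4 +
  -- 4·ε²/32 < ε²`.
  filter_upwards [mem_nhdsWithin_of_mem_nhds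
    (measureBall_mem_nhds hτ A (half_pos hε) (δ := ε ^ 2 / 32) (by positivity)),
    self_mem_nhdsWithin] with B hBA hB
  have h1 := re_star_mul_self_le hτ hBA (norm_sub_le_two hB hA)
  have h2 := hτ.norm_sq_le (B - A)
  rw [dist_eq_norm, ← map_sub]
  refine lt_of_pow_lt_pow_left₀ 2 hε.le ?_
  have : 0 < ε ^ 2 := by positivity
  nlinarith

theorem not_isCompact_unitBall (hM : IsTypeII₁Factor M) (hτ : IsFaithfulNormalTracialState M τ) :
    ¬ @IsCompact _ (measureTopology M τ) (unitBall M) := by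
  classical
  let _ := measureTopology M τ
  intro hK
  obtain ⟨t, ht, hcover⟩ := hK.elim_nhds_subcover
    (fun A => {B | B - A ∈ measureBall M τ (1 / 4) (1 / 32)})
    fun A _ => measureBall_mem_nhds hτ A (by norm_num) (by norm_num)
  -- `A` is taken orthogonal to all centres `B` of the finite cover, so `τ((A-B)*(A-B)) ≥ τ(A*A) ≥
  -- 1/2`, whereas the covering balls allow at most `1/16 + 4/32`.
  obtain ⟨A, hA, hA0, hA1⟩ := exists_common_zero hM hτ
    (t.image fun B => τ ∘ₗ LinearMap.mulLeft ℂ (star B))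
  obtain ⟨B, hB, hAB⟩ := Set.mem_iUnion₂.1 (hcover hA)
  have h0 : τ (star B * A) = 0 := hA0 _ (Finset.mem_image_of_mem _ hB)
  have h0' : τ (star A * B) = 0 := by
    have := hτ.map_star (star B * A)
    rwa [h0, star_zero, star_mul, star_star] at this
  have h1 := re_star_mul_self_le hτ hAB (norm_sub_le_two hA (ht B hB))
  have h2 : star (A - B) * (A - B) = star A * A - star A * B - star B * A + star B * B := by
    rw [star_sub]; noncomm_ring
  rw [h2, map_add, map_sub, map_sub, h0, h0'] at h1
  have h3 := (Complex.nonneg_iff.1 (hτ.nonneg B)).1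
  simp at h1
  norm_num at h1
  linarith

/-! ### Completeness of the unit ball -/

theorem isClosed_setOf_cauchySeq {H : Type*} [NormedAddCommGroup H] [InnerProductSpace ℂ H]
    {A : ℕ → H →L[ℂ] H} (hA : ∀ n, ‖A n‖ ≤ 1) :
    IsClosed {x | CauchySeq fun n => A n x} := by
  refine isClosed_of_closure_subset fun x hx => ?_
  refine Metric.cauchySeq_iff'.2 fun ε hε => ?_
  obtain ⟨y, hy, hxy⟩ := Metric.mem_closure_iff.1 hx (ε / 3) (by positivity)
  obtain ⟨N, hN⟩ := Metric.cauchySeq_iff'.1 hy (ε / 3) (by positivity)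
  refine ⟨N, fun n hn => ?_⟩
  have h : ∀ n, dist (A n x) (A n y) ≤ dist x y := fun n => by
    rw [dist_eq_norm, dist_eq_norm, ← map_sub]
    simpa using (A n).le_of_opNorm_le (hA n) (x - y)
  calc dist (A n x) (A N x) ≤ dist (A n x) (A n y) + dist (A n y) (A N y) + dist (A N y) (A N x) :=
        dist_triangle4 _ _ _ _
    _ ≤ dist x y + dist (A n y) (A N y) + dist x y := by
        gcongr
        · exact h n
        · rw [dist_comm]; exact h N
    _ < ε := by linarith [hN n hn]

/-- A bounded sequence in `M` that is fast Cauchy in measure converges strongly, and uniformly on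
large projections. -/
theorem exists_limit_of_fast_cauchy (hτ : IsFaithfulNormalTracialState M τ)
    {A : ℕ → M.toStarSubalgebra} (hA : ∀ n, A n ∈ unitBall M)
    (hcauchy : ∀ n, A n - A (n + 1) ∈ measureBall M τ ((1 / 2) ^ n) ((1 / 2) ^ n)) :
    ∃ B ∈ unitBall M, ∀ n, A n - B ∈ measureBall M τ (2 * (1 / 2) ^ n) (2 * (1 / 2) ^ n) := by
  choose E hE hAE hEτ using hcauchy
  -- On the range of `1 - Q n` all later increments are geometrically small, and subadditivity
  -- bounds the trace of `Q n` by the tail of the series.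
  choose Q hQ hQE hQmin using fun n => exists_join fun k => 1 - E (n + k)
  have hQτ : ∀ n, (τ (Q n)).re ≤ 2 * (1 / 2) ^ n := fun n => by
    refine hτ.re_join_le (fun k => (hE (n + k)).one_sub) (hQ n) (hQE n) (hQmin n) fun N => ?_
    calc ∑ k ∈ Finset.range N, (τ (1 - E (n + k))).re
        ≤ ∑ k ∈ Finset.range N, (1 / 2 : ℝ) ^ n * (1 / 2) ^ k := Finset.sum_le_sum fun k _ => by
          rw [← pow_add]; exact hEτ _
      _ = (1 / 2 : ℝ) ^ n * ∑ k ∈ Finset.range N, (1 / 2) ^ k := by rw [Finset.mul_sum]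
      _ ≤ (1 / 2 : ℝ) ^ n * 2 := by
          gcongr
          exact sum_geometric_two_le N
      _ = _ := mul_comm _ _
  have hfix : ∀ n k x, (E (n + k)).1 ((1 - Q n).1 x) = (1 - Q n).1 x := by
    intro n k x
    have h1 : Q n * (1 - E (n + k)) = 1 - E (n + k) :=
      Subtype.ext (ContinuousLinearMap.ext fun x => hQE n k x)
    have h2 := congrArg star h1
    rw [star_mul, (hQ n).isSelfAdjoint.star_eq, (hE _).one_sub.isSelfAdjoint.star_eq] at h2
    have h3 : (1 - E (n + k)) * (1 - Q n) = 0 := by rw [mul_sub, h2, mul_one, sub_self]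
    rw [sub_mul, one_mul, sub_eq_zero] at h3
    exact congrArg (fun a : M.toStarSubalgebra => a.1 x) h3.symm
  have hstep : ∀ n k x, dist ((A (n + k)).1 ((1 - Q n).1 x)) ((A (n + (k + 1))).1 ((1 - Q n).1 x))
      ≤ (1 / 2) ^ n * ‖(1 - Q n).1 x‖ * (1 / 2) ^ k := by
    intro n k x
    have h := ((A (n + k) - A (n + k + 1)) * E (n + k)).1.le_of_opNorm_le (hAE (n + k))
      ((1 - Q n).1 x)
    have e : ((A (n + k) - A (n + k + 1)) * E (n + k)).1 ((1 - Q n).1 x)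
        = (A (n + k)).1 ((1 - Q n).1 x) - (A (n + (k + 1))).1 ((1 - Q n).1 x) := by
      conv_rhs => rw [← hfix n k x]
      rfl
    rw [e] at h
    rw [dist_eq_norm]
    refine h.trans (le_of_eq ?_)
    rw [pow_add]; ring
  have hA' : ∀ n, ‖(A n).1‖ ≤ 1 := hA
  have hQc : ∀ n x, CauchySeq fun k => (A k).1 ((1 - Q n).1 x) := fun n x => by
    have h := cauchySeq_of_le_geometric _ _ (by norm_num) (hstep n · x)
    simp only [add_comm n] at h
    exact (cauchySeq_shift n).1 h
  obtain ⟨R, hR, hRQ, hRmin⟩ := exists_join fun n => 1 - Q n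
  -- The trace of `1 - R` is below every `τ(Q n)`, so faithfulness makes the ranges of the `1 - Q n`
  -- span a dense subspace; uniform boundedness then gives strong convergence everywhere.
  have hR1 : R = 1 := by
    have : 1 - R = 0 := by
      refine hτ.eq_zero_of_re_le_zero hR.one_sub ?_
      have hlim : Filter.Tendsto (fun n : ℕ => (2 : ℝ) * (1 / 2) ^ n) Filter.atTop (𝓝 0) := by
        simpa using (tendsto_pow_atTop_nhds_zero_of_lt_one (r := (1 / 2 : ℝ)) (by norm_num)
          (by norm_num)).const_mul 2
      refine ge_of_tendsto' hlim fun n => le_trans ?_ (hQτ n)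
      have h : 1 - Q n ≤ R := (proj_le_iff (hQ n).one_sub hR).2
        (Subtype.ext (ContinuousLinearMap.ext fun x => hRQ n x))
      have := hτ.re_mono h
      simp only [map_sub, Complex.sub_re] at this ⊢
      linarith
    exact (sub_eq_zero.1 this).symm
  have hcs : ∀ x, CauchySeq fun k => (A k).1 x := by
    let K : Submodule ℂ H :=
      { carrier := {x | CauchySeq fun k => (A k).1 x}
        add_mem' := fun {x y} hx hy => by
          have := CauchySeq.add hx hy
          simpa [Pi.add_def] using this
        zero_mem' := by simpa using cauchySeq_const (0 : H)
        smul_mem' := fun c x hx => by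
          have := (uniformContinuous_const_smul c).comp_cauchySeq hx
          simpa [Function.comp_def] using this }
    intro x
    have := hRmin K (isClosed_setOf_cauchySeq hA') hQc x
    rw [hR1] at this
    exact this
  choose f hf using fun x => cauchySeq_tendsto_of_complete (hcs x)
  let B : H →L[ℂ] H := continuousLinearMapOfTendsto (fun k => (A k).1) (tendsto_pi_nhds.2 hf)
  have hB : ∀ x, Filter.Tendsto (fun k => (A k).1 x) Filter.atTop (𝓝 (B x)) := hf
  have hBM : B ∈ M.toStarSubalgebra := by
    refine mem_of_commute _ fun c hc => ContinuousLinearMap.ext fun x => ?_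
    have h1 := (c.continuous.tendsto _).comp (hB x)
    have h2 : (fun k => (A k).1 (c x)) = c ∘ fun k => (A k).1 x := funext fun k =>
      (congrArg (fun a : H →L[ℂ] H => a x) (commute_of_mem (A k).2 hc)).symm
    exact tendsto_nhds_unique h1 (h2 ▸ hB (c x))
  refine ⟨⟨B, hBM⟩, ?_, fun n => ⟨1 - Q n, (hQ n).one_sub, ?_, ?_⟩⟩
  · refine B.opNorm_le_bound zero_le_one fun x => ?_
    exact le_of_tendsto' (hB x).norm fun k => (A k).1.le_of_opNorm_le (hA' k) x
  · refine ContinuousLinearMap.opNorm_le_bound _ (by positivity) fun x => ?_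
    change ‖(A n).1 ((1 - Q n).1 x) - B ((1 - Q n).1 x)‖ ≤ _
    have hlim : Filter.Tendsto (fun k => (A (n + k)).1 ((1 - Q n).1 x)) Filter.atTop
        (𝓝 (B ((1 - Q n).1 x))) := by
      simp only [add_comm n]
      exact (Filter.tendsto_add_atTop_iff_nat n).2 (hB _)
    have h := dist_le_of_le_geometric_of_tendsto₀ _ _ (by norm_num) (hstep n · x) hlim
    rw [dist_eq_norm, add_zero] at h
    refine h.trans ?_
    have h2 := norm_proj_le (coe_isStarProjection (hQ n).one_sub) x
    calc (1 / 2 : ℝ) ^ n * ‖(1 - Q n).1 x‖ / (1 - 1 / 2) = 2 * (1 / 2) ^ n * ‖(1 - Q n).1 x‖ := by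
          ring
      _ ≤ 2 * (1 / 2) ^ n * ‖x‖ := by gcongr
  · rw [sub_sub_cancel]
    exact hQτ n

theorem isCompleteFor_unitBall (hτ : IsFaithfulNormalTracialState M τ) :
    IsCompleteFor (measureTopology M τ) (unitBall M) := by
  intro F hF hS hcauchy
  have hpos : ∀ n : ℕ, (0 : ℝ) < (1 / 2) ^ n := fun n => by positivity
  have hT : ∀ n : ℕ, ∃ T ∈ F, ∀ A ∈ T, ∀ B ∈ T,
      A - B ∈ measureBall M τ ((1 / 2) ^ n) ((1 / 2) ^ n) := fun n => by
    obtain ⟨T, hT, h⟩ := hcauchy _ (measureBall_mem_nhds hτ 0 (hpos n) (hpos n))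
    exact ⟨T, hT, fun A hA B hB => by simpa using h A hA B hB⟩
  choose T hTF hT using hT
  -- Asking for membership in all `T k` with `k ≤ n` puts both `A n` and `A (n + 1)` in `T n`, which
  -- makes the sequence fast Cauchy.
  have hne : ∀ n, ∃ A, A ∈ unitBall M ∧ ∀ k ≤ n, A ∈ T k := fun n => by
    obtain ⟨A, hA⟩ := Filter.nonempty_of_mem (Filter.inter_mem hS
      ((Filter.biInter_mem (Set.finite_Iic n)).2 fun k _ => hTF k))
    exact ⟨A, hA.1, fun k hk => Set.mem_iInter₂.1 hA.2 k hk⟩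
  choose A hA hAT using hne
  obtain ⟨B, hB, hAB⟩ := exists_limit_of_fast_cauchy hτ hA fun n =>
    hT n _ (hAT n n le_rfl) _ (hAT (n + 1) n n.le_succ)
  refine ⟨B, hB, fun s hs => ?_⟩
  obtain ⟨ε, hε, δ, hδ, h⟩ := (mem_measure_nhds_iff hτ).1 hs
  -- The divisor `3` absorbs `2⁻ⁿ` from `C - A n` and `2·2⁻ⁿ` from `A n - B`.
  obtain ⟨n, hn⟩ := exists_pow_lt_of_lt_one (show 0 < min ε δ / 3 from
    div_pos (lt_min hε hδ) three_pos) (show (1 / 2 : ℝ) < 1 by norm_num)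
  refine Filter.mem_of_superset (hTF n) fun C hC => h C ?_
  have h1 := add_mem_measureBall hτ (hT n C hC _ (hAT n n le_rfl)) (hAB n)
  rw [sub_add_sub_cancel] at h1
  have h2 : (1 / 2 : ℝ) ^ n + 2 * (1 / 2) ^ n ≤ min ε δ := by linarith
  exact measureBall_mono M τ (h2.trans (min_le_left _ _)) (h2.trans (min_le_right _ _)) h1

end MeasureTop

/-- In the lattice of topologies, `t ≤ s` says that `t` is finer than `s`. -/
theorem theorem3p12 {H : Type*} [NormedAddCommGroup H] [InnerProductSpace ℂ H] [CompleteSpace H]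
    (M : VonNeumannAlgebra H) (hM : IsTypeII₁Factor M)
    (τ : M.toStarSubalgebra →ₗ[ℂ] ℂ) (hτ : IsFaithfulNormalTracialState M τ) :
    -- (i) the measure topology is coarser than the norm topology
    normTopology M ≤ measureTopology M τ ∧
    -- (ii) it is neither coarser nor finer than the ultraweak topology
    (¬ ultraweakTopology M ≤ measureTopology M τ ∧ ¬ measureTopology M τ ≤ ultraweakTopology M) ∧
    -- (iii) the trace is not continuous
    ¬ Continuous[measureTopology M τ, inferInstance] τ ∧
    -- (iv) the restriction of the trace to the unit ball is continuous
    @ContinuousOn _ _ (measureTopology M τ) inferInstance τ (unitBall M) ∧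
    -- (v) the unit ball is not compact
    ¬ @IsCompact _ (measureTopology M τ) (unitBall M) ∧
    -- (vi) the unit ball is complete
    IsCompleteFor (measureTopology M τ) (unitBall M) := by
  exact ⟨normTopology_le_measureTopology,
    ⟨not_ultraweakTopology_le hM hτ, not_measureTopology_le hM hτ⟩, not_continuous_trace hM hτ,
    continuousOn_trace hτ, not_isCompact_unitBall hM hτ, isCompleteFor_unitBall hτ⟩
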